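/- **Conventions.** Let $k$ be a $\sigma$-field of characteristic $0$, i.e. a field with an endomorphism $\sigma$. Put $P[x]=\{0\}\cup\{f\in\mathbb Z[x] : \text{the leading coefficient of } f \text{ is positive}\}$. A *$P[x]$-semimodule* in $\mathbb Z[x]^n$ is a subset $S$ containing $0$ and closed under addition and under multiplication by $P[x]$; it is *affine* if it is finitely generated. Then $S^{md}=\{u-v : u,v\in S\}$ is the $\mathbb Z[x]$-lattice generated by $S$, and $k[S]=\bigoplus_{u\in S}k\chi^u$ is a $k$-$\sigma$-algebra with $\chi^u\chi^v=\chi^{u+v}$ and $\sigma(\chi^u)=\chi^{xu}$. A *fan* is a nonempty finite family $\Sigma=\{S_i\}_i$ of affine $P[x]$-semimodules in $\mathbb Z[x]^n$ such that * (a) $S_i^{md}$ is the same lattice $\Sigma^{md}$ for all $i$; * (b) for all $i\neq j$ there is $u\in S_i$ with $-u\in S_j$ and $S_i+\mathbb Z[x](-u)=S_j+\mathbb Z[x]u$; * (c) for pairwise distinct $i,j,l$ there are $u,v,w$ as in (b) for the pairs $(i,j)$, $(j,l)$, $(l,i)$ with $S_i+\mathbb Z[x](-u)+\mathbb Z[x]w=S_j+\mathbb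 Z[x]u+\mathbb Z[x](-v)=S_l+\mathbb Z[x]v+\mathbb Z[x](-w)$. The *$P[\sigma]$-polynomial ring* in $m$ variables is $k[P[x]^m]$, with monomials $y^u$, $u\in P[x]^m$. An *affine $P[\sigma]$-variety* $V$ is the zero set, in all $\sigma$-field extensions $K$ of $k$, of a set of $P[\sigma]$-polynomials, where $a^g=\prod_i\sigma^i(a)^{c_i}$ for $g=\sum_i c_ix^i\in P[x]$, and $0^g=0$ for $g\neq0$. Its coordinate ring $R$ is the quotient of the $P[\sigma]$-polynomial ring by the ideal of all $P[\sigma]$-polynomials vanishing on $V$; its $K$-points are the $k$-$\sigma$-algebra homomorphisms $R\to K$; its topological space $\operatorname{Spec}^{P[\sigma]}(R)$ is the set of $P[\sigma]$-prime ideals, with closed sets $\{\mathfrak p: F\subseteq\mathfrak p\}$, $F\subseteq R$. Here an ideal is *$P[\sigma]$-prime* if it is prime, $\sigma$-stable, perfect ($f^g\in I$ with $0\ne g\in\mathbb N[x]$ implies $f\in I$), and $y^uf\in I$ implies $y^{gu}f\in I$ for all $u\in P[x]^m$, $0\neq g\in P[x]$. A *$P[\sigma]$-term* is a constant times a monomial;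 morphisms are natural maps on $K$-points that are given locally, on open sets, by fractions of $P[\sigma]$-terms with nowhere vanishing denominators. An *abstract $P[\sigma]$-variety* is glued from finitely many affine $P[\sigma]$-varieties $V_i$ along open subsets $V_{ji}\subseteq V_i$ by isomorphisms $g_{ji}\colon V_{ji}\to V_{ij}$ with $V_{ii}=V_i$, $g_{ii}=\mathrm{id}$, $g_{ij}=g_{ji}^{-1}$, $g_{ji}(V_{ji}\cap V_{li})=V_{ij}\cap V_{lj}$ and $g_{lj}\circ g_{ji}=g_{li}$ on $V_{ji}\cap V_{li}$; its open sets are the subsets that restrict to open subsets of each $V_i$. **Theorem.** Let $\Sigma=\{S_i\}_i$ be a fan in $\mathbb Z[x]^n$, and let $X_i=\operatorname{Spec}^{P[\sigma]}(k[S_i])$. For every $u\in S_i$ with $-u\in S_j$ and $W:=S_i+\mathbb Z[x](-u)=S_j+\mathbb Z[x]u$, glue $X_i$ to $X_j$ along the basic open sets $D(\chi^u)\subseteq X_i$ and $D(\chi^{-u})\subseteq X_j$ by the identity map of $\operatorname{Spec}^{P[\sigma]}(k[W])$, where $k[W]=k[S_i]_{\chi^u}=k[S_j]_{\chi^{-u}}$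 is obtained by inverting all $\chi^{gu}$, respectively $\chi^{-gu}$, $g\in P[x]$. Then the open set $D(\chi^u)\subseteq X_i$ does not depend on the choice of $u$, and these data satisfy the gluing conditions, so that they define an abstract $P[\sigma]$-variety $X_\Sigma$. This variety is toric with torus $T_\Sigma=\operatorname{Spec}^{P[\sigma]}(k[\Sigma^{md}])$: 1. $X_\Sigma$ is irreducible; 2. for all $i$, the inclusions $S_i\subseteq\Sigma^{md}$ induce one and the same morphism $T_\Sigma\to X_\Sigma$, and it is an isomorphism of $T_\Sigma$ onto an open subset of $X_\Sigma$; 3. the action of $T_\Sigma$ on itself, $(\varphi\psi)(\chi^u)=\varphi(\chi^u)\psi(\chi^u)$, extends to a $\sigma$-algebraic group action $T_\Sigma\times X_\Sigma\to X_\Sigma$, i.e. to a morphism satisfying the axioms of a group action. -/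

import Mathlib

open Polynomial
open scoped TensorProduct

universe u

namespace ToricPSigma

/-! ### Difference rings and difference fields -/

/-- A difference ring (`σ`-ring): a commutative ring with a ring endomorphism. -/
class SigmaRing (R : Type*) [CommRing R] where
  /-- The difference operator. -/
  sigma : R →+* R

/-- The difference operator `σ`. -/
abbrev sig {R : Type*} [CommRing R] [SigmaRing R] : R →+* R := SigmaRing.sigma

/-- A `σ`-field extension of the `σ`-field `k`. -/
structure SigmaExt (k : Type u) [Field k] [SigmaRing k] where
  /-- The underlying field. -/
  carrier : Type u
  [field : Field carrier]
  [algebra : Algebra k carrier]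
  [sigmaRing : SigmaRing carrier]
  sig_algebraMap : ∀ c : k, sig (algebraMap k carrier c) = algebraMap k carrier (sig c)

attribute [instance] SigmaExt.field SigmaExt.algebra SigmaExt.sigmaRing

instance {k : Type u} [Field k] [SigmaRing k] : CoeSort (SigmaExt k) (Type u) :=
  ⟨SigmaExt.carrier⟩

/-- Morphisms of `σ`-field extensions of `k`. -/
structure SigmaExt.Hom {k : Type u} [Field k] [SigmaRing k] (K L : SigmaExt k) where
  /-- The underlying `k`-algebra map. -/
  toAlgHom : K →ₐ[k] L
  comm : ∀ a : K, toAlgHom (sig a) = sig (toAlgHom a)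

/-- `a ^ g = ∏ σ^i(a)^(c_i)` for `g = ∑ c_i x^i` with natural coefficients. -/
noncomputable def natPow {R : Type*} [CommRing R] [SigmaRing R] (a : R) (g : ℕ[X]) : R :=
  ∏ i ∈ g.support, ((sig : R →+* R)^[i] a) ^ g.coeff i

/-- `a ^ g = ∏ σ^i(a)^(c_i)` for `g = ∑ c_i x^i` with integer coefficients, in a `σ`-field.
For `a = 0` and `g ≠ 0` the value is `0`, because `0 ^ c = 0` for every integer `c ≠ 0`. -/
noncomputable def intPow {K : Type*} [Field K] [SigmaRing K] (a : K) (g : ℤ[X]) : K :=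
  ∏ i ∈ g.support, ((sig : K →+* K)^[i] a) ^ (g.coeff i : ℤ)

/-! ### The semiring `P[x]` and `P[x]`-semimodules -/

/-- `P[x] = {f ∈ ℤ[x] | f ≥ 0}`, where `f > 0` iff the leading coefficient of `f` is positive. -/
def Px : Subsemiring ℤ[X] where
  carrier := {f | 0 ≤ f.leadingCoeff}
  mul_mem' {f g} hf hg := by
    simp only [Set.mem_ofPred_eq, leadingCoeff_mul] at *
    exact mul_nonneg hf hg
  one_mem' := by simp
  zero_mem' := by simp
  add_mem' {f g} hf hg := by
    simp only [Set.mem_ofPred_eq] at *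
    rcases lt_trichotomy f.degree g.degree with h | h | h
    · rwa [leadingCoeff_add_of_degree_lt h]
    · by_cases h0 : f.leadingCoeff + g.leadingCoeff = 0
      · have hf0 : f = 0 := leadingCoeff_eq_zero.1 (by linarith)
        have hg0 : g = 0 := leadingCoeff_eq_zero.1 (by linarith)
        simp [hf0, hg0]
      · rw [leadingCoeff_add_of_degree_eq h h0]
        linarith
    · rwa [leadingCoeff_add_of_degree_lt' h]

theorem mem_Px {f : ℤ[X]} : f ∈ Px ↔ 0 ≤ f.leadingCoeff := Iff.rfl

/-- The element `x` of `P[x]`. -/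
noncomputable def Px.x : Px := ⟨X, by simp [mem_Px]⟩

theorem mem_Px_or_neg_mem (f : ℤ[X]) : f ∈ Px ∨ -f ∈ Px := by
  rcases le_total 0 f.leadingCoeff with h | h
  · exact Or.inl h
  · exact Or.inr (by simpa [mem_Px] using h)

/-- The free `ℤ[x]`-module `ℤ[x]^n`. -/
abbrev ZxN (n : ℕ) : Type := Fin n → ℤ[X]

/-- A `P[x]`-semimodule in `ℤ[x]^n`. It is affine iff it is finitely generated (`Submodule.FG`). -/
abbrev Semimod (n : ℕ) : Type := Submodule Px (ZxN n)

/-- `ℤ[x](u)`, the `ℤ[x]`-submodule generated by `u`, regarded as a `P[x]`-semimodule. -/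
noncomputable def zspan {n : ℕ} (u : ZxN n) : Semimod n :=
  (Submodule.span ℤ[X] {u}).restrictScalars Px

/-- `S^md = {u - v | u, v ∈ S}`, the `ℤ[x]`-lattice generated by the `P[x]`-semimodule `S`. -/
def md {n : ℕ} (S : Semimod n) : Submodule ℤ[X] (ZxN n) where
  carrier := {w | ∃ u ∈ S, ∃ v ∈ S, w = u - v}
  add_mem' := by
    rintro _ _ ⟨u, hu, v, hv, rfl⟩ ⟨u', hu', v', hv', rfl⟩
    exact ⟨u + u', add_mem hu hu', v + v', add_mem hv hv', by abel⟩
  zero_mem' := ⟨0, zero_mem S, 0, zero_mem S, by simp⟩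
  smul_mem' := by
    rintro f _ ⟨u, hu, v, hv, rfl⟩
    rcases mem_Px_or_neg_mem f with h | h
    · exact ⟨f • u, S.smul_mem ⟨f, h⟩ hu, f • v, S.smul_mem ⟨f, h⟩ hv, smul_sub f u v⟩
    · refine ⟨(-f) • v, S.smul_mem ⟨-f, h⟩ hv, (-f) • u, S.smul_mem ⟨-f, h⟩ hu, ?_⟩
      rw [smul_sub, neg_smul, neg_smul]
      abel

/-! ### Fans -/

/-- `u ∈ S`, `-u ∈ S'` and `S + ℤ[x](-u) = S' + ℤ[x](u)`. -/
structure Adjoining {n : ℕ} (S S' : Semimod n) (u : ZxN n) : Prop where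
  mem : u ∈ S
  neg_mem : -u ∈ S'
  eq : S ⊔ zspan (-u) = S' ⊔ zspan u

/-- A fan: a compatible family of affine `P[x]`-semimodules in `ℤ[x]^n`. The lattice `M` is
`Σ^md`. -/
structure Fan (n : ℕ) (ι : Type) where
  /-- The members of the fan. -/
  S : ι → Semimod n
  fg : ∀ i, (S i).FG
  /-- The common lattice `Σ^md` of the members. -/
  M : Submodule ℤ[X] (ZxN n)
  md_eq : ∀ i, md (S i) = M
  pair : ∀ i j, i ≠ j → ∃ u, Adjoining (S i) (S j) u
  triple : ∀ i j l, i ≠ j → j ≠ l → l ≠ i → ∃ u v w,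
    Adjoining (S i) (S j) u ∧ Adjoining (S j) (S l) v ∧ Adjoining (S l) (S i) w ∧
    S i ⊔ zspan (-u) ⊔ zspan w = S j ⊔ zspan u ⊔ zspan (-v) ∧
    S j ⊔ zspan u ⊔ zspan (-v) = S l ⊔ zspan v ⊔ zspan (-w)

section Varieties

variable (k : Type u) [Field k] [SigmaRing k]

/-! ### `k`-`σ`-algebras with `P[σ]`-monomials -/

/-- A `k`-`σ`-algebra together with its `P[σ]`-monomials, which are the images `chi u` of the
elements `u` of a `P[x]`-semimodule `Mon`; the monomial `chi (g • u)` is the `g`-th power of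
`chi u`, and accordingly `σ (chi u) = chi (x • u)`. -/
structure PSigmaAlg where
  /-- The underlying ring. -/
  carrier : Type u
  [commRing : CommRing carrier]
  [algebra : Algebra k carrier]
  [sigmaRing : SigmaRing carrier]
  sig_algebraMap : ∀ c : k, sig (algebraMap k carrier c) = algebraMap k carrier (sig c)
  /-- The exponents of the `P[σ]`-monomials. -/
  Mon : Type
  [addCommMonoid : AddCommMonoid Mon]
  [module : Module Px Mon]
  /-- The `P[σ]`-monomial with a given exponent. -/
  chi : Multiplicative Mon →* carrier
  sig_chi : ∀ u : Mon, sig (chi (.ofAdd u)) = chi (.ofAdd (Px.x • u))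

attribute [instance] PSigmaAlg.commRing PSigmaAlg.algebra PSigmaAlg.sigmaRing
  PSigmaAlg.addCommMonoid PSigmaAlg.module

instance : CoeSort (PSigmaAlg k) (Type u) := ⟨PSigmaAlg.carrier⟩

/-- Multiplication by `x` on the exponents, as a homomorphism of monoids. -/
noncomputable def xSmul (N : Type) [AddCommMonoid N] [Module Px N] : N →+ N :=
  DistribSMul.toAddMonoidHom N Px.x

/-- The difference operator `σ (c χ^u) = σ(c) χ^(x u)` on the semimodule algebra. -/
noncomputable instance (N : Type) [AddCommMonoid N] [Module Px N] :
    SigmaRing (AddMonoidAlgebra k N) :=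
  ⟨(AddMonoidAlgebra.mapDomainRingHom k (xSmul N)).comp (AddMonoidAlgebra.mapRingHom N sig)⟩

/-- The `P[x]`-semimodule algebra `k[N]`: the `k`-vector space with basis `χ^u`, `u ∈ N`, with
`χ^u χ^v = χ^(u+v)` and `σ (c χ^u) = σ(c) χ^(x u)`. -/
noncomputable abbrev semialg (N : Type) [AddCommMonoid N] [Module Px N] : PSigmaAlg k where
  carrier := AddMonoidAlgebra k N
  sig_algebraMap c := by
    change (AddMonoidAlgebra.mapDomainRingHom k (xSmul N)).comp
      (AddMonoidAlgebra.mapRingHom N sig) _ = _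
    simp
  Mon := N
  chi := AddMonoidAlgebra.of k N
  sig_chi v := by
    change (AddMonoidAlgebra.mapDomainRingHom k (xSmul N)).comp
      (AddMonoidAlgebra.mapRingHom N sig) _ = _
    simp [xSmul]

variable {k}

namespace PSigmaAlg

variable (A B : PSigmaAlg k)

/-- The `P[σ]`-monomial with exponent `u`. -/
abbrev mono (u : A.Mon) : A := A.chi (.ofAdd u)

/-- A `P[σ]`-term is the product of a constant and a `P[σ]`-monomial. -/
def IsTerm (f : A) : Prop := ∃ (c : k) (u : A.Mon), f = c • A.mono u

/-- The tensor product `A ⊗ B` over `k`, with `σ (a ⊗ b) = σ a ⊗ σ b` and the `P[σ]`-monomials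
`χ^u ⊗ χ^v`. -/
noncomputable def tensor : PSigmaAlg k where
  carrier := A ⊗[k] B
  sigmaRing := ⟨Algebra.TensorProduct.mapRingHom (sig : k →+* k) (sig : A →+* A) (sig : B →+* B)
    (by ext c; exact A.sig_algebraMap c) (by ext c; exact B.sig_algebraMap c)⟩
  sig_algebraMap c := by
    change Algebra.TensorProduct.mapRingHom _ _ _ _ _ _ = _
    simp [Algebra.TensorProduct.algebraMap_apply, A.sig_algebraMap]
  Mon := A.Mon × B.Mon
  chi :=
    { toFun := fun w => A.mono w.toAdd.1 ⊗ₜ B.mono w.toAdd.2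
      map_one' := by simp [mono, Algebra.TensorProduct.one_def]
      map_mul' := by intro v w; simp [mono, Algebra.TensorProduct.tmul_mul_tmul] }
  sig_chi w := by
    change Algebra.TensorProduct.mapRingHom _ _ _ _ _ (A.mono w.1 ⊗ₜ B.mono w.2) =
      A.mono (Px.x • w.1) ⊗ₜ B.mono (Px.x • w.2)
    simp [mono, A.sig_chi, B.sig_chi]

/-! ### Points with values in `σ`-field extensions -/

/-- The `K`-points: homomorphisms of `k`-`σ`-algebras from `A` to `K`. For the coordinate ring
of an affine `P[σ]`-variety `V` these are the points of `V` with coordinates in `K`. -/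
@[ext]
structure Points (K : SigmaExt k) where
  /-- The underlying `k`-algebra map. -/
  toAlgHom : A →ₐ[k] K
  comm : ∀ f : A, toAlgHom (sig f) = sig (toAlgHom f)

instance (K : SigmaExt k) : CoeFun (A.Points K) (fun _ => A → K) := ⟨fun a => a.toAlgHom⟩

variable {A B}

/-- The map on points induced by a morphism of `σ`-field extensions. -/
def Points.map {K L : SigmaExt k} (h : K.Hom L) (a : A.Points K) : A.Points L where
  toAlgHom := h.toAlgHom.comp a.toAlgHom
  comm f := by simp [a.comm, h.comm]

/-- The first component of a point of a product. -/
noncomputable def Points.fst {K : SigmaExt k} (c : (A.tensor B).Points K) : A.Points K where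
  toAlgHom := AlgHom.comp (A := A) (B := A ⊗[k] B) c.toAlgHom Algebra.TensorProduct.includeLeft
  comm f := by
    have := c.comm (f ⊗ₜ 1 : A ⊗[k] B)
    rw [show (sig (show A.tensor B from (f ⊗ₜ 1 : A ⊗[k] B))) = (sig f ⊗ₜ 1 : A ⊗[k] B) by
      change Algebra.TensorProduct.mapRingHom _ _ _ _ _ _ = _
      simp] at this
    exact this

/-- The second component of a point of a product. -/
noncomputable def Points.snd {K : SigmaExt k} (c : (A.tensor B).Points K) : B.Points K where
  toAlgHom := AlgHom.comp (A := B) (B := A ⊗[k] B) c.toAlgHom Algebra.TensorProduct.includeRight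
  comm f := by
    have := c.comm (1 ⊗ₜ f : A ⊗[k] B)
    rw [show (sig (show A.tensor B from (1 ⊗ₜ f : A ⊗[k] B))) = (1 ⊗ₜ sig f : A ⊗[k] B) by
      change Algebra.TensorProduct.mapRingHom _ _ _ _ _ _ = _
      simp] at this
    exact this

/-! ### `P[σ]`-prime ideals and the spectrum -/

variable (A)

/-- `P[σ]`-prime ideals: ideals that are closed under `σ`, perfect, `P[σ]`-ideals, and prime.
For `A = k{y}/I` this says that the preimage in `k{y}` is a `P[σ]`-prime ideal. -/
structure IsPPrime (I : Ideal A) : Prop where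
  sig_mem : ∀ f ∈ I, sig f ∈ I
  perfect : ∀ (f : A) (g : ℕ[X]), g ≠ 0 → natPow f g ∈ I → f ∈ I
  pideal : ∀ (u : A.Mon) (f : A) (g : Px), g ≠ 0 → A.mono u * f ∈ I → A.mono (g • u) * f ∈ I
  prime : I.IsPrime

/-- `Spec^{P[σ]}(A)`, with the topology whose closed sets are the sets
`{p | F ⊆ p}` for subsets `F` of `A`. -/
def PSpec : Type u := {p : PrimeSpectrum A // A.IsPPrime p.asIdeal}

instance : TopologicalSpace A.PSpec :=
  inferInstanceAs (TopologicalSpace {p : PrimeSpectrum A // A.IsPPrime p.asIdeal})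

variable {A}

theorem sig_iterate_map {K : SigmaExt k} (a : A.Points K) (f : A) (i : ℕ) :
    a ((sig : A →+* A)^[i] f) = (sig : K →+* K)^[i] (a f) := by
  induction i generalizing f with
  | zero => rfl
  | succ i ih => rw [Function.iterate_succ_apply, Function.iterate_succ_apply, ih, a.comm]

theorem sig_iterate_eq_zero {K : SigmaExt k} {a : K} {i : ℕ}
    (h : (sig : K →+* K)^[i] a = 0) : a = 0 := by
  induction i generalizing a with
  | zero => exact h
  | succ i ih =>
    rw [Function.iterate_succ_apply] at h
    exact (map_eq_zero _).1 (ih h)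

theorem sig_iterate_mono (u : A.Mon) (i : ℕ) :
    (sig : A →+* A)^[i] (A.mono u) = A.mono (Px.x ^ i • u) := by
  induction i generalizing u with
  | zero => simp
  | succ i ih => rw [Function.iterate_succ_apply, A.sig_chi, ih, smul_smul, pow_succ]

theorem two_mul_sub_mem_Px {g : ℤ[X]} (hg : g ∈ Px) (h0 : g ≠ 0) :
    g + g - X ^ g.natDegree ∈ Px := by
  have hpos : 0 < g.leadingCoeff := lt_of_le_of_ne hg (Ne.symm (leadingCoeff_ne_zero.2 h0))
  have hdeg : (g + g - X ^ g.natDegree).natDegree ≤ g.natDegree := by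
    refine (natDegree_sub_le _ _).trans (max_le ((natDegree_add_le _ _).trans (by simp)) ?_)
    exact (natDegree_X_pow_le _)
  have hc : (g + g - X ^ g.natDegree).coeff g.natDegree = 2 * g.leadingCoeff - 1 := by
    rw [coeff_sub, coeff_add, coeff_X_pow_self, ← leadingCoeff]
    ring
  have hcp : 0 < (g + g - X ^ g.natDegree).coeff g.natDegree := by rw [hc]; linarith
  have hd : (g + g - X ^ g.natDegree).natDegree = g.natDegree :=
    le_antisymm hdeg (le_natDegree_of_ne_zero hcp.ne')
  rw [mem_Px, leadingCoeff, hd]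
  exact hcp.le

theorem Points.mono_smul_eq_zero {K : SigmaExt k} (a : A.Points K) {u : A.Mon} {g : Px}
    (hg : g ≠ 0) (h : a (A.mono u) = 0) : a (A.mono (g • u)) = 0 := by
  have h0 : (g : ℤ[X]) ≠ 0 := fun h => hg (Subtype.ext h)
  set d := (g : ℤ[X]).natDegree
  let r : Px := ⟨(g : ℤ[X]) + (g : ℤ[X]) - X ^ d, two_mul_sub_mem_Px g.2 h0⟩
  have hr : g + g = Px.x ^ d + r := by
    apply Subtype.ext
    simp [r, Px.x]
  have h1 : a (A.mono (Px.x ^ d • u)) = 0 := by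
    rw [← sig_iterate_mono, sig_iterate_map, h]
    exact iterate_map_zero _ _
  have h2 : a (A.mono (g • u)) * a (A.mono (g • u)) = 0 := by
    rw [← map_mul a.toAlgHom, ← map_mul A.chi, ← ofAdd_add, ← add_smul, hr, add_smul, ofAdd_add,
      map_mul A.chi, map_mul a.toAlgHom, h1, zero_mul]
  exact mul_self_eq_zero.1 h2

theorem Points.mono_x_smul {K : SigmaExt k} (a : A.Points K) (u : A.Mon) :
    a (A.mono (Px.x • u)) = sig (a (A.mono u)) := by
  rw [← a.comm, A.sig_chi]

/-- The kernel of a point is a `P[σ]`-prime ideal. -/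
theorem Points.isPPrime {K : SigmaExt k} (a : A.Points K) :
    A.IsPPrime (RingHom.ker a.toAlgHom) where
  sig_mem f hf := by
    rw [RingHom.mem_ker] at *
    rw [a.comm, hf, map_zero]
  perfect f g hg hf := by
    rw [RingHom.mem_ker, natPow, map_prod, Finset.prod_eq_zero_iff] at hf
    obtain ⟨i, -, hi⟩ := hf
    rw [map_pow] at hi
    have := eq_zero_of_pow_eq_zero hi
    rw [sig_iterate_map] at this
    exact sig_iterate_eq_zero this
  pideal v f g hg hf := by
    rw [RingHom.mem_ker, map_mul, mul_eq_zero] at *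
    exact hf.imp_left (a.mono_smul_eq_zero hg)
  prime := RingHom.ker_isPrime _

/-- The point of the spectrum underlying a `K`-point. -/
def Points.pt {K : SigmaExt k} (a : A.Points K) : A.PSpec :=
  ⟨⟨RingHom.ker a.toAlgHom, a.isPPrime.prime⟩, a.isPPrime⟩

/-! ### Affine `P[σ]`-varieties -/

/-- Evaluation of a `P[σ]`-polynomial `f` in `m` variables at `a ∈ K^m`. The ring
`k{y_1, …, y_m}^{P[σ]}` is `k[P[x]^m]`, with basis the `P[σ]`-monomials `y^u`, `u ∈ P[x]^m`. -/
noncomputable def evalP {m : ℕ} {K : SigmaExt k} (a : Fin m → K)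
    (f : AddMonoidAlgebra k (Fin m → Px)) : K :=
  f.coeff.sum fun u c => algebraMap k K c * ∏ i, intPow (a i) (u i : ℤ[X])

variable (A) in
/-- `A` is the coordinate ring `k{y_1, …, y_m}^{P[σ]} / I(V(F))` of an affine `P[σ]`-variety:
there is a surjection `π` of `k`-`σ`-algebras from the `P[σ]`-polynomial ring onto `A` whose kernel
consists of the `P[σ]`-polynomials that vanish at all solutions of `F` in all `σ`-field extensions,
and the `P[σ]`-monomials of `A` (and their `P[x]`-powers) are the images of those of the
`P[σ]`-polynomial ring. -/
def IsAffine : Prop :=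
  ∃ (m : ℕ) (F : Set (AddMonoidAlgebra k (Fin m → Px)))
    (π : (semialg k (Fin m → Px)) →ₐ[k] A) (q : (Fin m → Px) →ₗ[Px] A.Mon),
    Function.Surjective π ∧ Function.Surjective q ∧
    (∀ f, π (sig f) = sig (π f)) ∧
    (∀ v : Fin m → Px, π ((semialg k (Fin m → Px)).mono v) = A.mono (q v)) ∧
    ∀ f, π f = 0 ↔ ∀ (K : SigmaExt k) (a : Fin m → K),
      (∀ h ∈ F, evalP a h = 0) → evalP a f = 0

/-! ### Maps given locally by `P[σ]`-terms -/

/-- The relation `r` between points of `A` and points of `B` is, on a basic open neighbourhood of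
the point `a`, given by fractions of `P[σ]`-terms: there is a basic open set `D(h)` containing
`a` such that each point `a'` of it is related to a point `b'` at which every `P[σ]`-monomial
`χ^t` of `B` has the value `num t (a') / den t (a')`, where `num t` and `den t` are `P[σ]`-terms of
`A` and `den t` has no zero on `D(h)`. -/
def LocallyTerm (r : ∀ L : SigmaExt k, A.Points L → B.Points L → Prop)
    {K : SigmaExt k} (a : A.Points K) : Prop :=
  ∃ h : A, a h ≠ 0 ∧ ∃ num den : B.Mon → A,
    (∀ t, A.IsTerm (num t) ∧ A.IsTerm (den t)) ∧
    ∀ (L : SigmaExt k) (a' : A.Points L), a' h ≠ 0 →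
      ∃ b' : B.Points L, r L a' b' ∧
        ∀ t, a' (den t) ≠ 0 ∧ b' (B.mono t) * a' (den t) = a' (num t)

end PSigmaAlg

open PSigmaAlg

/-! ### Points of semimodule algebras -/

/-- The point of `k[N]` given by a morphism `N → K`. -/
noncomputable def pointOfHom {N : Type} [AddCommMonoid N] [Module Px N] {K : SigmaExt k}
    (f : Multiplicative N →* K)
    (hf : ∀ v : N, f (.ofAdd (Px.x • v)) = sig (f (.ofAdd v))) : (semialg k N).Points K where
  toAlgHom := AddMonoidAlgebra.lift k K N f
  comm p := by
    let l : AddMonoidAlgebra k N →ₐ[k] K := AddMonoidAlgebra.lift k K N f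
    let s : AddMonoidAlgebra k N →+* AddMonoidAlgebra k N :=
      (AddMonoidAlgebra.mapDomainRingHom k (xSmul N)).comp (AddMonoidAlgebra.mapRingHom N sig)
    have key : (l : AddMonoidAlgebra k N →+* K).comp s
        = (sig : K →+* K).comp (l : AddMonoidAlgebra k N →+* K) := by
      apply AddMonoidAlgebra.ringHom_ext
      · intro c
        simp [l, s, AddMonoidAlgebra.lift_single, Algebra.smul_def, K.sig_algebraMap]
      · intro v
        simpa [l, s, AddMonoidAlgebra.lift_single, xSmul] using hf v
    exact RingHom.congr_fun key p

theorem pointOfHom_mono {N : Type} [AddCommMonoid N] [Module Px N] {K : SigmaExt k}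
    (f : Multiplicative N →* K)
    (hf : ∀ v : N, f (.ofAdd (Px.x • v)) = sig (f (.ofAdd v))) (v : N) :
    pointOfHom f hf ((semialg k N).mono v) = f (.ofAdd v) :=
  AddMonoidAlgebra.lift_of f (.ofAdd v)

theorem semialg_points_ext {N : Type} [AddCommMonoid N] [Module Px N] {K : SigmaExt k}
    {a b : (semialg k N).Points K}
    (h : ∀ v : N, a ((semialg k N).mono v) = b ((semialg k N).mono v)) : a = b := by
  apply Points.ext
  apply (AddMonoidAlgebra.lift k K N).symm.injective
  exact MonoidHom.ext h

/-- The restriction of points along a morphism `N → N'` of `P[x]`-semimodules. -/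
noncomputable def restrict {N N' : Type} [AddCommMonoid N] [Module Px N] [AddCommMonoid N']
    [Module Px N'] (φ : N →ₗ[Px] N') {K : SigmaExt k} (c : (semialg k N').Points K) :
    (semialg k N).Points K :=
  pointOfHom ((c.toAlgHom : (semialg k N').carrier →* K).comp
      ((semialg k N').chi.comp (AddMonoidHom.toMultiplicative φ.toAddMonoidHom))) <| by
    intro v
    have h := c.mono_x_smul (φ v)
    have h' : (Px.x • φ v : N') = φ (Px.x • v) := (map_smul φ Px.x v).symm
    exact (congrArg (fun w : N' => c ((semialg k N').mono w)) h'.symm).trans h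

theorem restrict_mono {N N' : Type} [AddCommMonoid N] [Module Px N] [AddCommMonoid N']
    [Module Px N'] (φ : N →ₗ[Px] N') {K : SigmaExt k} (c : (semialg k N').Points K) (v : N) :
    restrict φ c ((semialg k N).mono v) = c ((semialg k N').mono (φ v)) :=
  pointOfHom_mono _ _ v

/-- The identity of the torus: all characters take the value `1`. -/
noncomputable instance {N : Type} [AddCommMonoid N] [Module Px N] {K : SigmaExt k} :
    One ((semialg k N).Points K) :=
  ⟨pointOfHom 1 (by simp)⟩

/-- The product `φψ` of points of `k[N]`, with `(φψ)(χ^u) = φ(χ^u) ψ(χ^u)`. -/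
noncomputable instance {N : Type} [AddCommMonoid N] [Module Px N] {K : SigmaExt k} :
    Mul ((semialg k N).Points K) :=
  ⟨fun a b => pointOfHom
    (((a.toAlgHom : (semialg k N).carrier →* K).comp (semialg k N).chi) *
      ((b.toAlgHom : (semialg k N).carrier →* K).comp (semialg k N).chi)) <| by
    intro v
    have ha := a.mono_x_smul v
    have hb := b.mono_x_smul v
    exact (congrArg₂ (· * ·) ha hb).trans (map_mul _ _ _).symm⟩

/-! ### Gluing and abstract `P[σ]`-varieties -/

variable (k) in
/-- Data for gluing affine `P[σ]`-varieties `V i` along subsets `U i j ⊆ V i`. The maps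
`U i j → U j i` are given on points by their graphs `glue i j`, naturally in the `σ`-field
extension. -/
structure GluingData where
  /-- The set of indices. -/
  ι : Type
  /-- The coordinate rings of the charts. -/
  V : ι → PSigmaAlg k
  /-- The part of chart `i` that is glued to chart `j`. -/
  U : ∀ i _ : ι, Set (V i).PSpec
  /-- The graph of the gluing map from `U i j` to `U j i`. -/
  glue : ∀ (i j : ι) (K : SigmaExt k), (V i).Points K → (V j).Points K → Prop
  glue_map : ∀ (i j : ι) (K L : SigmaExt k) (h : K.Hom L) (a : (V i).Points K)
    (b : (V j).Points K), glue i j K a b → glue i j L (a.map h) (b.map h)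

namespace GluingData

variable (X : GluingData k)

/-- The gluing data define an abstract `P[σ]`-variety: the charts are finitely many affine
`P[σ]`-varieties, the `U i j` are open, the relations `glue i j` are the graphs of isomorphisms
`g i j : U i j → U j i`, given locally by fractions of `P[σ]`-terms, with `g j i = (g i j)⁻¹`, and
`g i j` maps `U i j ∩ U i l` into `U j l`, with `g j l ∘ g i j = g i l` there. -/
structure IsAbstractVariety : Prop where
  finite : Finite X.ι
  affine : ∀ i, (X.V i).IsAffine
  isOpen : ∀ i j, IsOpen (X.U i j)
  glue_mem : ∀ i j K (a : (X.V i).Points K) b, X.glue i j K a b → a.pt ∈ X.U i j ∧ b.pt ∈ X.U j i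
  glue_existsUnique : ∀ i j K (a : (X.V i).Points K), a.pt ∈ X.U i j → ∃! b, X.glue i j K a b
  glue_regular : ∀ i j K (a : (X.V i).Points K), a.pt ∈ X.U i j →
    LocallyTerm (A := X.V i) (B := X.V j) (X.glue i j) a
  self : ∀ i, X.U i i = Set.univ ∧ ∀ K (a : (X.V i).Points K), X.glue i i K a a
  symm : ∀ i j K (a : (X.V i).Points K) b, X.glue i j K a b → X.glue j i K b a
  cocycle : ∀ i j l K (a : (X.V i).Points K) b, a.pt ∈ X.U i l → X.glue i j K a b →
    b.pt ∈ X.U j l ∧ ∀ c, X.glue j l K b c → X.glue i l K a c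

/-- The set of `K`-points of the glued object. -/
def Points (K : SigmaExt k) : Type u :=
  Quot fun a b : Σ i, (X.V i).Points K => X.glue a.1 b.1 K a.2 b.2

/-- The `K`-point of the glued object given by a `K`-point of a chart. -/
def chartPt (i : X.ι) {K : SigmaExt k} (a : (X.V i).Points K) : X.Points K := Quot.mk _ ⟨i, a⟩

/-- The map on points induced by a morphism of `σ`-field extensions. -/
def map {K L : SigmaExt k} (h : K.Hom L) : X.Points K → X.Points L :=
  Quot.map (fun a => ⟨a.1, a.2.map h⟩) fun _ _ r => X.glue_map _ _ _ _ h _ _ r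

/-- Identification of points of the spectra of the charts: the gluing map carries a `K`-point with
underlying point `p` to a `K`-point with underlying point `q`. -/
def SpecRel (p q : Σ i, (X.V i).PSpec) : Prop :=
  ∃ (K : SigmaExt k) (a : (X.V p.1).Points K) (b : (X.V q.1).Points K),
    a.pt = p.2 ∧ b.pt = q.2 ∧ X.glue p.1 q.1 K a b

/-- The topological space of the glued object. Being a quotient of the disjoint union of the
spaces of the charts, its open sets are those that restrict to open sets in each chart. -/
def Space : Type u := Quot X.SpecRel

instance : TopologicalSpace X.Space := inferInstanceAs (TopologicalSpace (Quot X.SpecRel))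

/-- The point of the space underlying a `K`-point. -/
def pt {K : SigmaExt k} : X.Points K → X.Space :=
  Quot.map (fun a => ⟨a.1, a.2.pt⟩) fun a b r => ⟨K, a.2, b.2, rfl, rfl, r⟩

variable {X}

/-- The set of points of the space that are hit by a map of functors `T → X`. -/
def image {T : PSigmaAlg k} (j : ∀ K : SigmaExt k, T.Points K → X.Points K) : Set X.Space :=
  {x | ∃ (K : SigmaExt k) (t : T.Points K), X.pt (j K t) = x}

/-- `j` is an isomorphism of the affine `P[σ]`-variety with coordinate ring `T` onto an open subset
of `X`: it is a morphism, its image is open, it is bijective onto the points lying in its image,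
and its inverse is given locally by fractions of `P[σ]`-terms. -/
structure IsOpenEmbedding {T : PSigmaAlg k} (j : ∀ K : SigmaExt k, T.Points K → X.Points K) :
    Prop where
  natural : ∀ K L (h : SigmaExt.Hom K L) t, j L (t.map h) = X.map h (j K t)
  regular : ∀ K (t : T.Points K), ∃ i,
    LocallyTerm (A := T) (B := X.V i) (fun L t' b' => j L t' = X.chartPt i b') t
  isOpen : IsOpen (image j)
  injective : ∀ K, Function.Injective (j K)
  surjOn : ∀ K (x : X.Points K), X.pt x ∈ image j → ∃ t, j K t = x
  inv_regular : ∀ i K (a : (X.V i).Points K), X.pt (X.chartPt i a) ∈ image j →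
    LocallyTerm (A := X.V i) (B := T) (fun L a' t' => j L t' = X.chartPt i a') a

/-- `m` is a `σ`-algebraic group action on `X` of the torus with coordinate ring `k[N]`: a
morphism `T × X → X` that satisfies the axioms of a group action. -/
structure IsTorusAction {N : Type} [AddCommMonoid N] [Module Px N]
    (m : ∀ K : SigmaExt k, (semialg k N).Points K → X.Points K → X.Points K) : Prop where
  natural : ∀ K L (h : SigmaExt.Hom K L) t x, m L (t.map h) (X.map h x) = X.map h (m K t x)
  regular : ∀ i K (c : ((semialg k N).tensor (X.V i)).Points K), ∃ j,
    LocallyTerm (A := (semialg k N).tensor (X.V i)) (B := X.V j)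
      (fun L c' b' => m L c'.fst (X.chartPt i c'.snd) = X.chartPt j b') c
  one : ∀ K x, m K 1 x = x
  mul : ∀ K s t x, m K (s * t) x = m K s (m K t x)

variable (X) in
/-- `X` is a toric `P[σ]`-variety with the torus `T = Spec^{P[σ]}(k[M])`, where `M` is a
`ℤ[x]`-lattice, embedded by `j`: it is an irreducible abstract `P[σ]`-variety, `j` embeds `T` as an
open subset, and the action of `T` on itself extends to a `σ`-algebraic group action of `T`
on `X`. -/
structure IsToricVia {n : ℕ} (M : Submodule ℤ[X] (ZxN n))
    (j : ∀ K : SigmaExt k, (semialg k (M.restrictScalars Px)).Points K → X.Points K) : Prop where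
  variety : X.IsAbstractVariety
  irreducible : IrreducibleSpace X.Space
  isOpenEmbedding : IsOpenEmbedding j
  action : ∃ m : ∀ K : SigmaExt k,
      (semialg k (M.restrictScalars Px)).Points K → X.Points K → X.Points K,
    IsTorusAction m ∧ ∀ K s t, m K s (j K t) = j K (s * t)

end GluingData

/-! ### The variety of a fan -/

/-- The inclusion of a member of the fan into `Σ^md`. -/
noncomputable def Fan.incl {n : ℕ} {ι : Type} (F : Fan n ι) (i : ι) :
    F.S i →ₗ[Px] (F.M.restrictScalars Px) :=
  Submodule.inclusion fun v hv => by
    rw [Submodule.restrictScalars_mem, ← F.md_eq i]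
    exact ⟨v, hv, 0, zero_mem _, by simp⟩

/-- The basic open subset `D(χ^u)` of `Spec^{P[σ]}(k[S])`, for `u ∈ S`. -/
def basicOpen {n : ℕ} {S : Semimod n} (v : S) : Set (semialg k S).PSpec :=
  {p | (semialg k S).mono v ∉ p.1.asIdeal}

variable (k) in
/-- The gluing data of the fan: `X_i = Spec^{P[σ]}(k[S_i])` is glued to `X_j` along the open
subsets `D(χ^u) ⊆ X_i` and `D(χ^{-u}) ⊆ X_j`, where `u ∈ S_i`, `-u ∈ S_j` and
`W = S_i + ℤ[x](-u) = S_j + ℤ[x](u)`, by the identity map of `Spec^{P[σ]}(k[W])`, where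
`k[W]` is the common localization `k[S_i]_{χ^u} = k[S_j]_{χ^{-u}}`. -/
noncomputable def Fan.variety {n : ℕ} {ι : Type} (F : Fan n ι) : GluingData k where
  ι := ι
  V i := semialg k (F.S i)
  U i j := {p | ∃ (v : ZxN n) (hv : Adjoining (F.S i) (F.S j) v),
    p ∈ basicOpen (⟨v, hv.mem⟩ : F.S i)}
  glue i j K a b := ∃ (v : ZxN n) (W : Semimod n) (_ : Adjoining (F.S i) (F.S j) v)
    (_ : W = F.S i ⊔ zspan (-v)) (hi : F.S i ≤ W) (hj : F.S j ≤ W)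
    (c : (semialg k W).Points K),
    restrict (Submodule.inclusion hi) c = a ∧ restrict (Submodule.inclusion hj) c = b
  glue_map := by
    rintro i j K L h _ _ ⟨v, W, hv, hW, hi, hj, c, rfl, rfl⟩
    refine ⟨v, W, hv, hW, hi, hj, c.map h, ?_, ?_⟩ <;>
    · apply semialg_points_ext
      intro w
      exact (restrict_mono _ (c.map h) w).trans
        (congrArg h.toAlgHom (restrict_mono _ c w).symm)

end Varieties

end ToricPSigma

namespace ToricPSigma

/-! ### Large powers of `x` -/

/-! Everything is checked on field-valued points, where a point of `k[S]` amounts to a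
`σ`-compatible character of `S`. Two facts carry the argument. First, the exponents of monomials
outside a `P[σ]`-prime ideal form a semimodule that is also a face (`IsPPrime.units`,
`IsPPrime.add_mem_units_iff`): perfectness makes `χ^u` and `χ^(x^N u)` vanish together, and large
powers of `x` dominate every `g` in `P[x]`. Second, a character extends to a larger semimodule by
`χ^(s-t) = χ^s / χ^t` as soon as the denominators do not vanish (`exists_restrict_eq`).

Hence the points of `D(χ^u)` are the points of `k[S + ℤ[x](-u)]`, and `basicOpen_subset` makes this
open set independent of `u`. On triple overlaps, fan axiom (c) supplies one semimodule containing
all three members, and a point of it restricts to three mutually glued points; this is `cocycle`.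

Affineness and irreducibility come from the generic point: `k[S]` is a domain with injective `σ`, so
its zero ideal is `P[σ]`-prime and is the kernel of a point over the fraction field. The generic
points of all charts are restrictions of the generic point of the torus, so they are glued together.
The torus is the locus where no character vanishes, a single basic open set in each chart because
`S` is finitely generated. It acts by multiplication of characters, which respects the gluing. -/

theorem exists_X_pow_add_mem_Px (f : ℤ[X]) : ∃ N : ℕ, (X ^ N + f : ℤ[X]) ∈ Px := by
  -- One above the degree, so that the power of `x` supplies the leading coefficient `1`.
  refine ⟨f.natDegree + 1, ?_⟩
  have h : f.degree < (X ^ (f.natDegree + 1) : ℤ[X]).degree := by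
    rw [degree_X_pow]
    exact degree_le_natDegree.trans_lt (by exact_mod_cast Nat.lt_succ_self _)
  rw [mem_Px, leadingCoeff_add_of_degree_lt' h]
  simp

theorem exists_add_mem_Px (f : ℤ[X]) : ∃ r : Px, (r + f : ℤ[X]) ∈ Px := by
  obtain ⟨N, hN⟩ := exists_X_pow_add_mem_Px f
  exact ⟨⟨X ^ N, by simp [mem_Px]⟩, hN⟩

/-- This makes `χ^(g u)` a divisor of some `χ^(x^N u) = σ^N(χ^u)`, which transfers non-vanishing
from `χ^u` to all its powers. -/
theorem Px.exists_add_eq_x_pow (g : Px) : ∃ (N : ℕ) (r : Px), r + g = Px.x ^ N := by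
  obtain ⟨N, hN⟩ := exists_X_pow_add_mem_Px (-(g : ℤ[X]))
  exact ⟨N, ⟨_, hN⟩, Subtype.ext (by simp [Px.x])⟩

/-! ### Values of points at monomials -/

section

variable {k : Type u} [Field k] [SigmaRing k]

namespace PSigmaAlg

variable {A : PSigmaAlg k} {K : SigmaExt k}

theorem mono_zero : A.mono 0 = 1 := map_one A.chi

theorem mono_add (u v : A.Mon) : A.mono (u + v) = A.mono u * A.mono v :=
  map_mul A.chi (.ofAdd u) (.ofAdd v)

theorem isTerm_mono (u : A.Mon) : A.IsTerm (A.mono u) := ⟨1, u, (one_smul k _).symm⟩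

namespace Points

variable (a : A.Points K)

theorem apply_mono_zero : a (A.mono 0) = 1 := by
  rw [mono_zero]
  exact map_one a.toAlgHom

theorem apply_mono_add (u v : A.Mon) : a (A.mono (u + v)) = a (A.mono u) * a (A.mono v) := by
  rw [mono_add]
  exact map_mul a.toAlgHom _ _

end Points

/-! ### Monomials outside a `P[σ]`-prime ideal -/

variable {I : Ideal A}

/-- Since `f^x = σ(f)`, perfectness with exponent `x` is the converse of `σ`-stability. -/
theorem IsPPrime.sig_mem_iff (hI : A.IsPPrime I) (f : A) : sig f ∈ I ↔ f ∈ I := by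
  refine ⟨fun h => hI.perfect f X X_ne_zero ?_, hI.sig_mem f⟩
  have hs : (X : ℕ[X]).support = {1} := by
    rw [← monomial_one_one_eq_X]
    exact support_monomial 1 one_ne_zero
  simpa [natPow, hs] using h

theorem IsPPrime.mono_x_pow_smul_mem_iff (hI : A.IsPPrime I) (u : A.Mon) (N : ℕ) :
    A.mono (Px.x ^ N • u) ∈ I ↔ A.mono u ∈ I := by
  induction N with
  | zero => simp
  | succ N ih =>
    rw [pow_succ', mul_smul, ← ih]
    change A.chi (.ofAdd _) ∈ I ↔ _
    rw [← A.sig_chi, hI.sig_mem_iff]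

/-- The exponents of the monomials outside a `P[σ]`-prime ideal form a `P[x]`-semimodule. -/
def IsPPrime.units (hI : A.IsPPrime I) : Submodule Px A.Mon where
  carrier := {u | A.mono u ∉ I}
  zero_mem' := by
    change A.mono 0 ∉ I
    rw [mono_zero]
    exact fun h => hI.prime.ne_top ((Ideal.eq_top_iff_one I).2 h)
  add_mem' {u v} hu hv := by
    change A.mono (u + v) ∉ I
    rw [mono_add]
    exact fun h => (hI.prime.mem_or_mem h).elim hu hv
  smul_mem' g u hu := by
    change A.mono (g • u) ∉ I
    -- With `x^N = r + g`, the monomial `χ^(g u)` divides `χ^(x^N u)`, which lies in `I` only if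
    -- `χ^u` does.
    obtain ⟨N, r, h⟩ := Px.exists_add_eq_x_pow g
    intro hg
    apply hu
    rw [← hI.mono_x_pow_smul_mem_iff u N, ← h, add_smul, mono_add]
    exact I.mul_mem_left _ hg

/-- The face property: non-vanishing of a product of monomials passes to each factor. -/
theorem IsPPrime.add_mem_units_iff (hI : A.IsPPrime I) {u v : A.Mon} :
    u + v ∈ hI.units ↔ u ∈ hI.units ∧ v ∈ hI.units := by
  refine ⟨fun h => ⟨fun hu => h ?_, fun hv => h ?_⟩, fun h => add_mem h.1 h.2⟩
  · rw [mono_add]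
    exact I.mul_mem_right _ hu
  · rw [mono_add]
    exact I.mul_mem_left _ hv

namespace Points

variable (a : A.Points K)

/-- The exponents of the monomials that do not vanish at a point. -/
def units : Submodule Px A.Mon := a.isPPrime.units

variable {a}

theorem mem_units {u : A.Mon} : u ∈ a.units ↔ a (A.mono u) ≠ 0 := by
  change ¬ (A.mono u ∈ RingHom.ker a.toAlgHom) ↔ _
  rw [RingHom.mem_ker]

theorem notMem_pt {f : A} : f ∉ a.pt.1.asIdeal ↔ a f ≠ 0 := by
  change ¬ (f ∈ RingHom.ker a.toAlgHom) ↔ _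
  rw [RingHom.mem_ker]

end Points

/-! ### Points over residue fields -/

/-- The difference operator on the residue field of a `P[σ]`-prime ideal. -/
noncomputable def residueSig (p : A.PSpec) :
    FractionRing (A ⧸ p.1.asIdeal) →+* FractionRing (A ⧸ p.1.asIdeal) :=
  IsLocalization.map (M := nonZeroDivisors (A ⧸ p.1.asIdeal))
    (T := nonZeroDivisors (A ⧸ p.1.asIdeal)) _
    (Ideal.quotientMap p.1.asIdeal sig fun f hf => p.2.sig_mem f hf)
    (by
      have := p.1.isPrime
      -- Perfectness makes `σ` injective on the quotient domain, so it extends to fractions.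
      exact nonZeroDivisors_le_comap_nonZeroDivisors_of_injective _
        (Ideal.quotientMap_injective' fun f hf => (p.2.sig_mem_iff f).1 hf))

theorem residueSig_algebraMap (p : A.PSpec) (f : A) :
    residueSig p (algebraMap (A ⧸ p.1.asIdeal) _ (Ideal.Quotient.mk _ f)) =
      algebraMap (A ⧸ p.1.asIdeal) _ (Ideal.Quotient.mk _ (sig f)) := by
  rw [residueSig, IsLocalization.map_eq]
  rfl

/-- The residue `σ`-field of a `P[σ]`-prime ideal. -/
noncomputable def residueExt (p : A.PSpec) : SigmaExt k :=
  haveI := p.1.isPrime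
  { carrier := FractionRing (A ⧸ p.1.asIdeal)
    sigmaRing := ⟨residueSig p⟩
    sig_algebraMap := fun c => by
      rw [IsScalarTower.algebraMap_apply k (A ⧸ p.1.asIdeal) (FractionRing (A ⧸ p.1.asIdeal)),
        IsScalarTower.algebraMap_apply k (A ⧸ p.1.asIdeal) (FractionRing (A ⧸ p.1.asIdeal))]
      refine (residueSig_algebraMap p (algebraMap k A c)).trans ?_
      rw [A.sig_algebraMap]
      rfl }

/-- The map to the residue field has kernel `p`; this reduces questions about the spectrum to
field-valued points. -/
theorem exists_point (p : A.PSpec) : ∃ (K : SigmaExt k) (a : A.Points K), a.pt = p := by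
  have := p.1.isPrime
  let φ : A →ₐ[k] FractionRing (A ⧸ p.1.asIdeal) :=
    (IsScalarTower.toAlgHom k (A ⧸ p.1.asIdeal) (FractionRing (A ⧸ p.1.asIdeal))).comp
      (Ideal.Quotient.mkₐ k p.1.asIdeal)
  refine ⟨residueExt p, ⟨φ, fun f => (residueSig_algebraMap p f).symm⟩, ?_⟩
  apply Subtype.ext
  apply PrimeSpectrum.ext
  ext f
  change algebraMap (A ⧸ p.1.asIdeal) (FractionRing (A ⧸ p.1.asIdeal)) (Ideal.Quotient.mk _ f) = 0
    ↔ _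
  rw [FaithfulSMul.algebraMap_eq_zero_iff, Ideal.Quotient.eq_zero_iff_mem]

end PSigmaAlg
end
end ToricPSigma

namespace ToricPSigma

open PSigmaAlg

variable {k : Type u} [Field k] [SigmaRing k]

/-! ### Points of semimodule algebras -/

section Points

variable {N N' N'' : Type} [AddCommMonoid N] [Module Px N] [AddCommMonoid N'] [Module Px N']
  [AddCommMonoid N''] [Module Px N''] {K L : SigmaExt k}

theorem exists_point_of_hom (f : N → K) (h0 : f 0 = 1) (hadd : ∀ u v, f (u + v) = f u * f v)
    (hx : ∀ u, f (Px.x • u) = sig (f u)) :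
    ∃ a : (semialg k N).Points K, ∀ u, a ((semialg k N).mono u) = f u :=
  ⟨pointOfHom ⟨⟨fun u => f u.toAdd, h0⟩, fun u v => hadd u.toAdd v.toAdd⟩ hx,
    pointOfHom_mono _ _⟩

theorem one_mono (u : N) : (1 : (semialg k N).Points K) ((semialg k N).mono u) = 1 :=
  pointOfHom_mono _ _ u

theorem mul_mono (a b : (semialg k N).Points K) (u : N) :
    (a * b) ((semialg k N).mono u) = a ((semialg k N).mono u) * b ((semialg k N).mono u) :=
  pointOfHom_mono _ _ u

theorem restrict_restrict (φ : N →ₗ[Px] N') (ψ : N' →ₗ[Px] N'')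
    (c : (semialg k N'').Points K) : restrict φ (restrict ψ c) = restrict (ψ ∘ₗ φ) c :=
  semialg_points_ext fun v => by
    rw [restrict_mono, restrict_mono, restrict_mono, LinearMap.comp_apply]

theorem restrict_mul (φ : N →ₗ[Px] N') (c d : (semialg k N').Points K) :
    restrict φ (c * d) = restrict φ c * restrict φ d :=
  semialg_points_ext fun v => by
    rw [restrict_mono, mul_mono, mul_mono, restrict_mono, restrict_mono]

theorem restrict_map (φ : N →ₗ[Px] N') (h : K.Hom L) (c : (semialg k N').Points K) :
    restrict φ (c.map h) = (restrict φ c).map h :=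
  semialg_points_ext fun v =>
    (restrict_mono φ (c.map h) v).trans (congrArg h.toAlgHom (restrict_mono φ c v).symm)

theorem map_mul_points (h : K.Hom L) (a b : (semialg k N).Points K) :
    (a * b).map h = a.map h * b.map h :=
  semialg_points_ext fun v =>
    ((congrArg h.toAlgHom (mul_mono a b v)).trans (map_mul h.toAlgHom _ _)).trans
      (mul_mono (a.map h) (b.map h) v).symm

/-- A point of `k[N]` extends to `k[N']` if each element of `N'` is a difference of elements of `N`
the second of which gives a monomial that does not vanish at the point. -/
theorem exists_restrict_eq (φ : N →ₗ[Px] N') (hφ : Function.Injective φ)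
    (a : (semialg k N).Points K)
    (H : ∀ w : N', ∃ s t : N, w + φ t = φ s ∧ t ∈ a.units) :
    ∃ c : (semialg k N').Points K, restrict φ c = a := by
  choose s t hst ht using H
  have ht' : ∀ w, a ((semialg k N).mono (t w)) ≠ 0 := fun w => Points.mem_units.1 (ht w)
  -- The quotient does not depend on the representation of `w` as a difference. Multiplicativity,
  -- compatibility with `σ` and the restriction formula all follow by choosing a convenient
  -- representation.
  have key : ∀ (w : N') (s' t' : N), w + φ t' = φ s' → t' ∈ a.units →
      a ((semialg k N).mono (s w)) / a ((semialg k N).mono (t w)) =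
        a ((semialg k N).mono s') / a ((semialg k N).mono t') := by
    intro w s' t' h h'
    rw [div_eq_div_iff (ht' w) (Points.mem_units.1 h'), ← Points.apply_mono_add,
      ← Points.apply_mono_add]
    congr 2
    apply hφ
    rw [map_add, map_add, ← hst, ← h]
    abel
  let f : N' → K := fun w => a ((semialg k N).mono (s w)) / a ((semialg k N).mono (t w))
  have h0 : f 0 = 1 := by
    refine (key 0 0 0 (by simp) (zero_mem _)).trans ?_
    exact div_self (Points.mem_units.1 (zero_mem a.units))
  have hadd : ∀ u v, f (u + v) = f u * f v := by
    intro u v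
    refine (key (u + v) (s u + s v) (t u + t v) ?_ (add_mem (ht u) (ht v))).trans ?_
    · rw [map_add, map_add, ← hst, ← hst]
      abel
    · simp only [f]
      rw [div_mul_div_comm]
      congr 1 <;> exact Points.apply_mono_add a _ _
  have hx : ∀ u, f (Px.x • u) = sig (f u) := by
    intro u
    refine (key (Px.x • u) (Px.x • s u) (Px.x • t u) ?_
      (Submodule.smul_mem _ _ (ht u))).trans ?_
    · rw [map_smul, map_smul, ← hst, smul_add]
    · simp only [f]
      rw [map_div₀]
      congr 1 <;> exact Points.mono_x_smul a _
  obtain ⟨c, hc⟩ := exists_point_of_hom f h0 hadd hx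
  refine ⟨c, semialg_points_ext fun v => ?_⟩
  rw [restrict_mono, hc]
  refine (key (φ v) v 0 (by simp) (zero_mem _)).trans ?_
  exact (congrArg (_ / ·) (Points.apply_mono_zero a)).trans (div_one _)

/-- The value at `w` is the quotient of the values at `φ s` and `φ t`, both determined by the
restriction. -/
theorem restrict_injective (φ : N →ₗ[Px] N')
    (H : ∀ w : N', ∃ s t : N, w + φ t = φ s ∧ ∀ c : (semialg k N').Points K, φ t ∈ c.units) :
    Function.Injective fun c : (semialg k N').Points K => restrict φ c := by
  intro c d h
  refine semialg_points_ext fun w => ?_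
  obtain ⟨s, t, hst, ht⟩ := H w
  have hs : ∀ s : N, c ((semialg k N').mono (φ s)) = d ((semialg k N').mono (φ s)) := fun s => by
    rw [← restrict_mono, ← restrict_mono]
    exact congrArg (fun e : (semialg k N).Points K => e ((semialg k N).mono s)) h
  have := hs s
  rw [← hst, Points.apply_mono_add, Points.apply_mono_add, hs t] at this
  exact mul_right_cancel₀ (Points.mem_units.1 (ht d)) this

end Points

/-! ### Generic points -/

/-- Coefficients embed `ℤ[x]` additively into a power of `ℤ`. Unique sums are what make the
semimodule algebras domains. -/
theorem uniqueSums_intPoly : UniqueSums ℤ[X] :=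
  UniqueSums.of_injective_addHom (G := ℕ → ℤ) ⟨fun f : ℤ[X] => f.coeff, fun f g => funext (coeff_add f g)⟩
    (fun _ _ h => Polynomial.ext fun n => congrFun h n) inferInstance

section Generic

variable {n : ℕ} (S : Semimod n)

omit [SigmaRing k] in
theorem noZeroDivisors_semialg : NoZeroDivisors (AddMonoidAlgebra k S) := by
  have := uniqueSums_intPoly
  have : UniqueSums S :=
    UniqueSums.of_injective_addHom S.subtype.toAddMonoidHom.toAddHom
      Subtype.val_injective inferInstance
  infer_instance

theorem xSmul_injective : Function.Injective (xSmul S) := by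
  intro u v h
  apply Subtype.ext
  funext i
  have h' : (X : ℤ[X]) * u.1 i = X * v.1 i := congrArg (fun w : S => w.1 i) h
  exact mul_left_cancel₀ X_ne_zero h'

/-- Here `σ` is a field embedding on coefficients followed by the injective map `u ↦ x u` on
exponents. -/
theorem sig_semialg_injective :
    Function.Injective (sig : (semialg k S).carrier →+* (semialg k S).carrier) := by
  intro f g h
  have h1 : Function.Injective (AddMonoidAlgebra.mapDomain (R := k) (xSmul S)) :=
    AddMonoidAlgebra.mapDomain_injective (xSmul_injective S)
  have h2 : Function.Injective (AddMonoidAlgebra.mapRingHom S (sig : k →+* k)) :=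
    AddMonoidAlgebra.map_injective (sig : k →+* k).toAddMonoidHom (sig : k →+* k).injective
  exact h2 (h1 h)

theorem mono_ne_zero (u : S) : (semialg k S).mono u ≠ 0 :=
  fun h => one_ne_zero (α := k) (AddMonoidAlgebra.single_eq_zero.1 h)

/-- In a domain with injective `σ`, a product of powers of the `σ^i(f)` vanishes only if `f` does,
and monomials can be cancelled. -/
theorem isPPrime_bot : (semialg k S).IsPPrime ⊥ := by
  have := noZeroDivisors_semialg (k := k) S
  have hi : ∀ i, Function.Injective (sig : (semialg k S).carrier →+* _)^[i] :=
    fun i => (sig_semialg_injective S).iterate i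
  refine ⟨fun f hf => ?_, fun f g hg hf => ?_, fun u f g hg hf => ?_, ?_⟩
  · rw [Ideal.mem_bot] at *
    rw [hf, map_zero]
  · rw [Ideal.mem_bot] at *
    obtain ⟨i, -, h⟩ := Finset.prod_eq_zero_iff.1 hf
    exact hi i ((eq_zero_of_pow_eq_zero h).trans (iterate_map_zero _ _).symm)
  · rw [Ideal.mem_bot] at *
    rw [(mul_eq_zero.1 hf).resolve_left (mono_ne_zero S u), mul_zero]
  · exact Ideal.isPrime_bot

/-- The generic point of `Spec^{P[σ]}(k[S])`. -/
noncomputable def genericPt : (semialg k S).PSpec := ⟨⟨⊥, (isPPrime_bot S).prime⟩, isPPrime_bot S⟩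

theorem genericPt_specializes (p : (semialg k S).PSpec) : genericPt S ⤳ p := by
  refine Topology.IsInducing.subtypeVal.specializes_iff.1 ?_
  exact (PrimeSpectrum.le_iff_specializes _ _).1 (bot_le (a := p.1.asIdeal))

end Generic
end ToricPSigma

namespace ToricPSigma

open PSigmaAlg

/-! ### Powers with exponents in `ℤ[x]` -/

section IntPow

variable {K : Type*} [Field K] [SigmaRing K]

theorem sig_iterate_ne_zero {b : K} (hb : b ≠ 0) (i : ℕ) : (sig : K →+* K)^[i] b ≠ 0 := by
  rw [← RingHom.coe_pow]
  exact (_root_.map_ne_zero _).2 hb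

theorem intPow_zero (b : K) : intPow b 0 = 1 := by simp [intPow]

theorem intPow_monomial (b : K) (i : ℕ) (c : ℤ) :
    intPow b (monomial i c) = ((sig : K →+* K)^[i] b) ^ c := by
  by_cases hc : c = 0
  · simp [hc, intPow]
  · simp [intPow, support_monomial i hc]

theorem intPow_eq_prod_range (b : K) {g : ℤ[X]} {N : ℕ} (h : g.natDegree < N) :
    intPow b g = ∏ i ∈ Finset.range N, ((sig : K →+* K)^[i] b) ^ g.coeff i := by
  refine Finset.prod_subset (fun i hi => ?_) fun i _ hi => ?_
  · exact Finset.mem_range.2 ((le_natDegree_of_mem_supp i hi).trans_lt h)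
  · rw [notMem_support_iff.1 hi, zpow_zero]

/-- Nonvanishing matters: for `b = 0` and `h = -g ≠ 0` the left side is `1` and the right side is
`0`. -/
theorem intPow_add {b : K} (hb : b ≠ 0) (g h : ℤ[X]) :
    intPow b (g + h) = intPow b g * intPow b h := by
  have h1 := natDegree_add_le g h
  rw [intPow_eq_prod_range b (N := max g.natDegree h.natDegree + 1) (by omega),
    intPow_eq_prod_range b (g := g) (N := max g.natDegree h.natDegree + 1) (by omega),
    intPow_eq_prod_range b (g := h) (N := max g.natDegree h.natDegree + 1) (by omega),
    ← Finset.prod_mul_distrib]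
  refine Finset.prod_congr rfl fun i _ => ?_
  rw [coeff_add, zpow_add₀ (sig_iterate_ne_zero hb i)]

end IntPow

variable {k : Type u} [Field k] [SigmaRing k]

section

variable {A : PSigmaAlg k} {K : SigmaExt k}

theorem PSigmaAlg.Points.apply_mono_nsmul (a : A.Points K) (m : ℕ) (u : A.Mon) :
    a (A.mono (m • u)) = a (A.mono u) ^ m := by
  induction m with
  | zero => rw [zero_smul, pow_zero, a.apply_mono_zero]
  | succ m ih => rw [succ_nsmul, pow_succ, a.apply_mono_add, ih]

theorem PSigmaAlg.Points.apply_mono_x_pow_smul (a : A.Points K) (i : ℕ) (u : A.Mon) :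
    a (A.mono (Px.x ^ i • u)) = (sig : K →+* K)^[i] (a (A.mono u)) := by
  rw [← sig_iterate_mono, sig_iterate_map]

theorem natCast_smul_x_pow (i m : ℕ) : ((m • Px.x ^ i : Px) : ℤ[X]) = monomial i (m : ℤ) := by
  rw [nsmul_eq_mul, Subsemiring.coe_mul, ← C_mul_X_pow_eq_monomial]
  simp only [Px.x, SubmonoidClass.mk_pow, eq_intCast, Int.cast_natCast]
  exact congrArg (· * _) (map_natCast Px.subtype m)

/-- Induction on `g` passes through polynomials outside `P[x]`, for which `χ^(g u)` has no meaning.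
Writing `g` as a difference of elements of `P[x]` gives a statement that survives the induction. -/
theorem PSigmaAlg.Points.apply_mono_smul_eq_mul_intPow (a : A.Points K) {u : A.Mon}
    (hu : u ∈ a.units) (g : ℤ[X]) (p q : Px) (h : (p : ℤ[X]) = q + g) :
    a (A.mono (p • u)) = a (A.mono (q • u)) * intPow (a (A.mono u)) g := by
  have hb : a (A.mono u) ≠ 0 := Points.mem_units.1 hu
  have hmon : ∀ (i m : ℕ), a (A.mono ((m • Px.x ^ i : Px) • u)) =
      intPow (a (A.mono u)) (monomial i (m : ℤ)) := by
    intro i m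
    rw [intPow_monomial, smul_assoc, Points.apply_mono_nsmul, Points.apply_mono_x_pow_smul,
      zpow_natCast]
  induction g using Polynomial.induction_on' generalizing p q with
  | add g g' hg hg' =>
    -- The intermediate exponent `q + g` may leave `P[x]`; shifting by `r` repairs this, and the
    -- nonzero factor `χ^(r u)` is cancelled at the end.
    obtain ⟨r, hr⟩ := exists_add_mem_Px (q + g)
    have h1 := hg ⟨_, hr⟩ (r + q) (by simp [add_assoc])
    have h2 := hg' (r + p) ⟨_, hr⟩ (by simp [h, add_assoc])
    rw [h1, add_smul, add_smul, a.apply_mono_add, a.apply_mono_add] at h2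
    have h3 : a (A.mono (r • u)) ≠ 0 := Points.mem_units.1 (Submodule.smul_mem _ r hu)
    rw [intPow_add hb]
    refine mul_left_cancel₀ h3 (h2.trans ?_)
    ring
  | monomial i c =>
    obtain ⟨m, rfl | rfl⟩ := c.eq_nat_or_neg
    · have : p = q + m • Px.x ^ i := Subtype.ext (by rw [h, ← natCast_smul_x_pow]; rfl)
      rw [this, add_smul, a.apply_mono_add, hmon]
    · have : q = p + m • Px.x ^ i := by
        apply Subtype.ext
        have := natCast_smul_x_pow i m
        rw [Subsemiring.coe_add, this, h, map_neg]
        ring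
      rw [this, add_smul, a.apply_mono_add, hmon, mul_assoc, ← intPow_add hb, ← map_add,
        add_neg_cancel, map_zero, intPow_zero, mul_one]

theorem PSigmaAlg.Points.intPow_apply_mono (a : A.Points K) {u : A.Mon} (hu : u ∈ a.units)
    (g : Px) : intPow (a (A.mono u)) g = a (A.mono (g • u)) := by
  rw [a.apply_mono_smul_eq_mul_intPow hu g g 0 (by simp), zero_smul, a.apply_mono_zero, one_mul]

end

/-! ### Affineness of semimodule algebras -/

section

variable {N : Type} [AddCommMonoid N] [Module Px N] {N' : Type} [AddCommMonoid N'] [Module Px N']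

variable (k) in
/-- The homomorphism `k[N] → k[N']` induced by a morphism `N → N'`. -/
noncomputable def semialgMap (q : N →ₗ[Px] N') : (semialg k N) →ₐ[k] (semialg k N') :=
  AddMonoidAlgebra.mapDomainAlgHom k k q.toAddMonoidHom

theorem semialgMap_mono (q : N →ₗ[Px] N') (v : N) :
    semialgMap k q ((semialg k N).mono v) = (semialg k N').mono (q v) :=
  AddMonoidAlgebra.mapDomain_single

theorem semialgMap_sig (q : N →ₗ[Px] N') (f : semialg k N) :
    semialgMap k q (sig f) = sig (semialgMap k q f) := by
  have : (semialgMap k q : semialg k N →+* semialg k N').comp sig =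
      (sig : semialg k N' →+* semialg k N').comp (semialgMap k q) := by
    apply AddMonoidAlgebra.ringHom_ext
    · intro c
      have h1 := (semialg k N).sig_algebraMap c
      have h2 := (semialg k N').sig_algebraMap c
      change semialgMap k q (sig (algebraMap k (semialg k N) c)) =
        sig (semialgMap k q (algebraMap k (semialg k N) c))
      rw [h1, AlgHom.commutes, AlgHom.commutes, h2]
    · intro v
      change semialgMap k q (sig ((semialg k N).mono v)) =
        sig (semialgMap k q ((semialg k N).mono v))
      rw [semialgMap_mono]
      refine (congrArg _ ((semialg k N).sig_chi v)).trans
        (Eq.trans ?_ ((semialg k N').sig_chi (q v)).symm)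
      refine (semialgMap_mono q _).trans ?_
      rw [map_smul]
  exact RingHom.congr_fun this f

theorem semialgMap_surjective {q : N →ₗ[Px] N'} (hq : Function.Surjective q) :
    Function.Surjective (semialgMap k q) := by
  intro f
  induction f using AddMonoidAlgebra.induction_linear with
  | zero => exact ⟨0, map_zero _⟩
  | add f g hf hg =>
    obtain ⟨f, rfl⟩ := hf
    obtain ⟨g, rfl⟩ := hg
    exact ⟨f + g, map_add _ _ _⟩
  | single v c =>
    obtain ⟨v, rfl⟩ := hq v
    exact ⟨AddMonoidAlgebra.single v c, AddMonoidAlgebra.mapDomain_single⟩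

/-- Both sides are additive in `f`. On a monomial, `q v` is the sum of the `v i • q (e_i)`, and `a`
turns `P[x]`-multiples of exponents into powers because no value on the image of `q` is zero. -/
theorem evalP_eq_apply {m : ℕ} {K : SigmaExt k} (q : (Fin m → Px) →ₗ[Px] N)
    (a : (semialg k N).Points K) (hu : ∀ v, q v ∈ a.units)
    (f : AddMonoidAlgebra k (Fin m → Px)) :
    evalP (fun i => a ((semialg k N).mono (q (Pi.single i 1)))) f = a (semialgMap k q f) := by
  induction f using AddMonoidAlgebra.induction_linear with
  | zero =>
    rw [map_zero]
    exact (Finsupp.sum_zero_index).trans (map_zero a.toAlgHom).symm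
  | add f g hf hg =>
    rw [map_add]
    refine Eq.trans ?_ ((congrArg₂ (· + ·) hf hg).trans (map_add a.toAlgHom _ _).symm)
    exact Finsupp.sum_add_index' (by simp) (by intros; rw [map_add, add_mul])
  | single v c =>
    have h1 : (AddMonoidAlgebra.single v c : AddMonoidAlgebra k (Fin m → Px)) =
        c • (semialg k (Fin m → Px)).mono v := by
      change _ = c • AddMonoidAlgebra.single v 1
      simp
    have h2 : q v = ∑ i, v i • q (Pi.single i 1) := by
      conv_lhs => rw [pi_eq_sum_univ' v, map_sum]
      simp only [← map_smul]
    have h3 : ∀ s : Finset (Fin m), a ((semialg k N).mono (∑ i ∈ s, v i • q (Pi.single i 1))) =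
        ∏ i ∈ s, a ((semialg k N).mono (v i • q (Pi.single i 1))) := by
      intro s
      induction s using Finset.cons_induction with
      | empty => exact a.apply_mono_zero
      | cons i s hi ih =>
        rw [Finset.sum_cons, Finset.prod_cons, ← ih]
        exact a.apply_mono_add _ _
    have h4 : evalP (fun i => a ((semialg k N).mono (q (Pi.single i 1))))
        (AddMonoidAlgebra.single v c) = algebraMap k K c * ∏ i,
          intPow (a ((semialg k N).mono (q (Pi.single i 1)))) (v i : ℤ[X]) :=
      Finsupp.sum_single_index (by simp)
    rw [h4, h1, map_smul, semialgMap_mono, h2, map_smul, h3, Algebra.smul_def]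
    congr 1
    exact Finset.prod_congr rfl fun i _ => a.intPow_apply_mono (hu _) (v i)

end

/-- The equations are the whole kernel of the presentation. A polynomial vanishing at all solutions
vanishes at the generic point, whose kernel is zero, so it lies in the kernel of the presentation.
-/
theorem isAffine_semialg {n : ℕ} (S : Semimod n) (hS : S.FG) : (semialg k S).IsAffine := by
  have : Module.Finite Px S := Module.Finite.of_fg hS
  obtain ⟨m, q, hq⟩ := Module.Finite.exists_fin' Px S
  obtain ⟨K, a, ha⟩ := exists_point (genericPt (k := k) S)
  have hu : ∀ v, q v ∈ a.units := fun v => by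
    have h : (semialg k S).mono (q v) ∉ (genericPt (k := k) S).1.asIdeal := mono_ne_zero S (q v)
    rw [← ha] at h
    exact Points.mem_units.2 (Points.notMem_pt.1 h)
  refine ⟨m, {f | semialgMap k q f = 0}, semialgMap k q, q, semialgMap_surjective hq, hq,
    semialgMap_sig q, semialgMap_mono q, fun f => ⟨fun h K b hb => hb f h, fun h => ?_⟩⟩
  by_contra hf
  have hf' : semialgMap k q f ∉ (genericPt (k := k) S).1.asIdeal := hf
  rw [← ha] at hf'
  refine Points.notMem_pt.1 hf' ?_
  rw [← evalP_eq_apply q a hu f]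
  refine h K _ fun g hg => ?_
  rw [evalP_eq_apply q a hu g, show semialgMap k q g = 0 from hg]
  exact map_zero a.toAlgHom

end ToricPSigma

namespace ToricPSigma

open PSigmaAlg

/-! ### Adjoining semimodules -/

section Adjoining

variable {n : ℕ} {S S' : Semimod n} {u v w : ZxN n}

theorem mem_zspan : w ∈ zspan v ↔ ∃ g : ℤ[X], g • v = w := by
  rw [zspan, Submodule.restrictScalars_mem, Submodule.mem_span_singleton]

theorem self_mem_zspan (v : ZxN n) : v ∈ zspan v := mem_zspan.2 ⟨1, one_smul _ _⟩

theorem zspan_neg (v : ZxN n) : zspan (-v) = zspan v := by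
  ext w
  simp only [mem_zspan]
  constructor <;> rintro ⟨g, rfl⟩ <;> exact ⟨-g, by simp⟩

theorem zspan_le (h : v ∈ S) (h' : -v ∈ S) : zspan v ≤ S := by
  intro w hw
  obtain ⟨g, rfl⟩ := mem_zspan.1 hw
  rcases mem_Px_or_neg_mem g with hg | hg
  · exact S.smul_mem ⟨g, hg⟩ h
  · have : (-g) • -v ∈ S := S.smul_mem ⟨-g, hg⟩ h'
    rwa [neg_smul_neg] at this

theorem Adjoining.symm (h : Adjoining S S' v) : Adjoining S' S (-v) where
  mem := h.neg_mem
  neg_mem := by simpa using h.mem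
  eq := by simpa using h.eq.symm

theorem adjoining_refl (S : Semimod n) : Adjoining S S 0 :=
  ⟨zero_mem _, by simp, by simp⟩

theorem Adjoining.right_le (h : Adjoining S S' v) : S' ≤ S ⊔ zspan (-v) := h.eq ▸ le_sup_left

/-- Elements of `S + ℤ[x](-v)` are differences of an element of `S` and a multiple of `v`. -/
theorem exists_add_smul_mem (hw : w ∈ S ⊔ zspan (-v)) (hv : v ∈ S) :
    ∃ g : Px, w + (g : ℤ[X]) • v ∈ S := by
  obtain ⟨s, hs, z, hz, rfl⟩ := Submodule.mem_sup.1 hw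
  rw [zspan_neg] at hz
  obtain ⟨f, rfl⟩ := mem_zspan.1 hz
  -- The coefficient `f` may be negative; a dominating `r` in `P[x]` brings `r + f` back into
  -- `P[x]`.
  obtain ⟨r, hr⟩ := exists_add_mem_Px f
  refine ⟨r, ?_⟩
  have : s + ((r : ℤ[X]) + f) • v ∈ S := add_mem hs (S.smul_mem ⟨_, hr⟩ hv)
  rw [add_smul] at this
  rwa [add_assoc, add_comm (f • v)]

end Adjoining

variable {k : Type u} [Field k] [SigmaRing k] {n : ℕ}

/-! ### Extension of points to larger semimodules -/

section Extension

variable {S S' W : Semimod n} {K : SigmaExt k} {v w : ZxN n}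

theorem restrict_inclusion_mono {S W : Semimod n} (h : S ≤ W) (c : (semialg k W).Points K)
    (s : ZxN n) (hs : s ∈ S) :
    restrict (Submodule.inclusion h) c ((semialg k S).mono ⟨s, hs⟩) =
      c ((semialg k W).mono ⟨s, h hs⟩) :=
  restrict_mono _ _ _

theorem mem_units_restrict {S W : Semimod n} (h : S ≤ W) (c : (semialg k W).Points K)
    {s : ZxN n} (hs : s ∈ S) :
    (⟨s, hs⟩ : S) ∈ (restrict (Submodule.inclusion h) c).units ↔ (⟨s, h hs⟩ : W) ∈ c.units := by
  rw [Points.mem_units, Points.mem_units, restrict_inclusion_mono]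

/-- The product of `χ^w` and `χ^(-w)` is `1`. -/
theorem mem_units_of_neg_mem (c : (semialg k W).Points K) (hw : w ∈ W) (hw' : -w ∈ W) :
    (⟨w, hw⟩ : W) ∈ c.units := by
  have h : (⟨w, hw⟩ + ⟨-w, hw'⟩ : W) ∈ c.units := by
    have : (⟨w, hw⟩ + ⟨-w, hw'⟩ : W) = 0 := Subtype.ext (add_neg_cancel w)
    rw [this]
    exact zero_mem _
  exact (c.isPPrime.add_mem_units_iff.1 h).1

theorem exists_extension (h : S ≤ W) (a : (semialg k S).Points K)
    (H : ∀ w ∈ W, ∃ t : S, t ∈ a.units ∧ w + t ∈ S) :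
    ∃ c : (semialg k W).Points K, restrict (Submodule.inclusion h) c = a :=
  exists_restrict_eq _ (Submodule.inclusion_injective h) a fun w => by
    obtain ⟨t, ht, hs⟩ := H w w.2
    exact ⟨⟨_, hs⟩, t, rfl, ht⟩

theorem exists_extension_sup (h : S ≤ S ⊔ zspan (-v)) (a : (semialg k S).Points K) (hv : v ∈ S)
    (ha : (⟨v, hv⟩ : S) ∈ a.units) :
    ∃ c : (semialg k ↥(S ⊔ zspan (-v))).Points K, restrict (Submodule.inclusion h) c = a :=
  exists_extension h a fun w hw => by
    obtain ⟨g, hg⟩ := exists_add_smul_mem hw hv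
    refine ⟨g • ⟨v, hv⟩, Submodule.smul_mem _ g ha, ?_⟩
    exact hg

/-- Used on triple overlaps: the two denominators, multiples of `w` and of `v`, are cleared one
after the other. -/
theorem exists_extension_sup_sup (h : S ≤ W) (hW : W ≤ S ⊔ zspan (-v) ⊔ zspan (-w))
    (a : (semialg k S).Points K) (hv : v ∈ S) (ha : (⟨v, hv⟩ : S) ∈ a.units) (hw : w ∈ S)
    (ha' : (⟨w, hw⟩ : S) ∈ a.units) :
    ∃ c : (semialg k W).Points K, restrict (Submodule.inclusion h) c = a :=
  exists_extension h a fun y hy => by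
    obtain ⟨g, hg⟩ := exists_add_smul_mem (hW hy) ((le_sup_left : S ≤ S ⊔ zspan (-v)) hw)
    obtain ⟨g', hg'⟩ := exists_add_smul_mem hg hv
    refine ⟨g • ⟨w, hw⟩ + g' • ⟨v, hv⟩,
      add_mem (Submodule.smul_mem _ g ha') (Submodule.smul_mem _ g' ha), ?_⟩
    rw [add_assoc] at hg'
    exact hg'

/-- A point of `k[S + ℤ[x](-v)]` at an element of it, computed from its restriction to `k[S]`. -/
theorem apply_mono_mul_eq (h : S ≤ W) (c : (semialg k W).Points K) (hw : w ∈ W) (hv : v ∈ S)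
    (hs : w + v ∈ S) :
    c ((semialg k W).mono ⟨w, hw⟩) *
      restrict (Submodule.inclusion h) c ((semialg k S).mono ⟨v, hv⟩) =
      restrict (Submodule.inclusion h) c ((semialg k S).mono ⟨w + v, hs⟩) := by
  rw [restrict_inclusion_mono, restrict_inclusion_mono]
  exact (c.apply_mono_add _ _).symm

end Extension

/-! ### Basic open sets and independence of the choice of `u` -/

theorem mem_basicOpen_pt {S : Semimod n} {K : SigmaExt k} (a : (semialg k S).Points K) (v : S) :
    a.pt ∈ basicOpen v ↔ v ∈ a.units := Iff.rfl

theorem mem_basicOpen {S : Semimod n} (p : (semialg k S).PSpec) (v : S) :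
    p ∈ basicOpen v ↔ v ∈ p.2.units := Iff.rfl

theorem isOpen_basicOpen {S : Semimod n} (v : S) : IsOpen (basicOpen (k := k) v) :=
  (PrimeSpectrum.basicOpen ((semialg k S).mono v)).2.preimage continuous_subtype_val

/-- Since `-w` lies in `S' ⊆ S + ℤ[x](-v)`, some `-w + g v` lies in `S`. Thus `χ^w` divides `χ^(g
v)`, which is nonzero wherever `χ^v` is. -/
theorem basicOpen_subset {S S' : Semimod n} {v w : ZxN n} (h : Adjoining S S' v)
    (h' : Adjoining S S' w) :
    basicOpen (k := k) (⟨v, h.mem⟩ : S) ⊆ basicOpen (⟨w, h'.mem⟩ : S) := by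
  intro p hp
  rw [mem_basicOpen] at *
  obtain ⟨g, hg⟩ := exists_add_smul_mem (h.right_le h'.neg_mem) h.mem
  have : (⟨_, hg⟩ + ⟨w, h'.mem⟩ : S) = g • ⟨v, h.mem⟩ := Subtype.ext (by
    change -w + (g : ℤ[X]) • v + w = (g : ℤ[X]) • v
    abel)
  have hu := Submodule.smul_mem _ g hp
  rw [← this] at hu
  exact (p.2.add_mem_units_iff.1 hu).2

/-! ### The gluing data of a fan -/

namespace Fan

variable {ι : Type} (F : Fan n ι)

theorem exists_adjoining (i j : ι) : ∃ v, Adjoining (F.S i) (F.S j) v := by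
  by_cases h : i = j
  · subst h
    exact ⟨0, adjoining_refl _⟩
  · exact F.pair i j h

theorem U_eq {i j : ι} {v : ZxN n} (hv : Adjoining (F.S i) (F.S j) v) :
    (F.variety k).U i j = basicOpen (k := k) (⟨v, hv.mem⟩ : F.S i) :=
  Set.Subset.antisymm (fun _ ⟨_, hw, hp⟩ => basicOpen_subset hw hv hp) fun _ hp => ⟨v, hv, hp⟩

variable {F} {i j l : ι} {K : SigmaExt k}

theorem pt_mem_U {v : ZxN n} (hv : Adjoining (F.S i) (F.S j) v) {a : (semialg k (F.S i)).Points K} :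
    a.pt ∈ (F.variety k).U i j ↔ (⟨v, hv.mem⟩ : F.S i) ∈ a.units := by
  rw [U_eq F hv]
  exact mem_basicOpen_pt a _

/-- The gluing relation asks for a point over the exact sum `S_i + ℤ[x](-v)`. Any larger `W`
suffices, by restriction to that sum, which is what triple overlaps need. -/
theorem glue_of_restrict {v : ZxN n} (hv : Adjoining (F.S i) (F.S j) v) {W : Semimod n}
    (hi : F.S i ≤ W) (hj : F.S j ≤ W) (hvW : -v ∈ W) (c : (semialg k W).Points K) :
    (F.variety k).glue i j K (restrict (Submodule.inclusion hi) c)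
      (restrict (Submodule.inclusion hj) c) := by
  have h : F.S i ⊔ zspan (-v) ≤ W := sup_le hi (zspan_le hvW (by simpa using hi hv.mem))
  refine ⟨v, _, hv, rfl, le_sup_left, hv.right_le, restrict (Submodule.inclusion h) c, ?_, ?_⟩ <;>
  exact restrict_restrict _ _ _

theorem glue_refl (a : (semialg k (F.S i)).Points K) : (F.variety k).glue i i K a a := by
  have := glue_of_restrict (adjoining_refl (F.S i)) le_rfl le_rfl (by simp) a
  have h : restrict (Submodule.inclusion le_rfl) a = a :=
    semialg_points_ext fun v => restrict_inclusion_mono le_rfl a v.1 v.2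
  rwa [h] at this

theorem glue_symm {a : (semialg k (F.S i)).Points K} {b : (semialg k (F.S j)).Points K}
    (h : (F.variety k).glue i j K a b) : (F.variety k).glue j i K b a := by
  obtain ⟨v, W, hv, rfl, hi, hj, c, rfl, rfl⟩ := h
  exact glue_of_restrict hv.symm hj hi
    (by simpa using (le_sup_left : F.S i ≤ F.S i ⊔ zspan (-v)) hv.mem) c

theorem pt_mem_U_of_glue {a : (semialg k (F.S i)).Points K} {b : (semialg k (F.S j)).Points K}
    (h : (F.variety k).glue i j K a b) : a.pt ∈ (F.variety k).U i j := by
  obtain ⟨v, W, hv, rfl, hi, hj, c, rfl, rfl⟩ := h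
  rw [pt_mem_U hv, mem_units_restrict]
  exact mem_units_of_neg_mem c _ ((le_sup_right : zspan (-v) ≤ _) (self_mem_zspan _))

/-- Glued points take compatible values. -/
theorem glue_apply_mul {a : (semialg k (F.S i)).Points K} {b : (semialg k (F.S j)).Points K}
    (h : (F.variety k).glue i j K a b) {w v : ZxN n} (hw : w ∈ F.S j) (hv : v ∈ F.S i)
    (hs : w + v ∈ F.S i) :
    b ((semialg k (F.S j)).mono ⟨w, hw⟩) * a ((semialg k (F.S i)).mono ⟨v, hv⟩) =
      a ((semialg k (F.S i)).mono ⟨w + v, hs⟩) := by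
  obtain ⟨_, W, _, _, hi, hj, c, rfl, rfl⟩ := h
  rw [restrict_inclusion_mono hj]
  exact apply_mono_mul_eq hi c _ hv hs

theorem exists_glue {a : (semialg k (F.S i)).Points K} (h : a.pt ∈ (F.variety k).U i j) :
    ∃ b, (F.variety k).glue i j K a b := by
  obtain ⟨v, hv⟩ := F.exists_adjoining i j
  obtain ⟨c, rfl⟩ := exists_extension_sup le_sup_left a hv.mem ((pt_mem_U hv).1 h)
  exact ⟨_, glue_of_restrict hv le_sup_left hv.right_le
    ((le_sup_right : zspan (-v) ≤ _) (self_mem_zspan _)) c⟩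

/-- Two gluings may use different witnesses `v`, but for one fixed `v` both points satisfy `b(χ^w)
a(χ^(g v)) = a(χ^(w + g v))` with a nonzero factor. -/
theorem glue_unique {a : (semialg k (F.S i)).Points K} {b b' : (semialg k (F.S j)).Points K}
    (h : (F.variety k).glue i j K a b) (h' : (F.variety k).glue i j K a b') : b = b' := by
  obtain ⟨v, hv⟩ := F.exists_adjoining i j
  have ha := (pt_mem_U hv).1 (pt_mem_U_of_glue h)
  refine semialg_points_ext fun w => ?_
  obtain ⟨g, hg⟩ := exists_add_smul_mem (hv.right_le w.2) hv.mem
  have hg' : (g • ⟨v, hv.mem⟩ : F.S i) ∈ a.units := Submodule.smul_mem _ g ha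
  exact mul_right_cancel₀ (Points.mem_units.1 hg')
    ((glue_apply_mul h w.2 _ hg).trans (glue_apply_mul h' w.2 _ hg).symm)

theorem glue_eq {a b : (semialg k (F.S i)).Points K} (h : (F.variety k).glue i i K a b) : a = b :=
  glue_unique (glue_refl a) h

theorem cocycle {a : (semialg k (F.S i)).Points K} {b : (semialg k (F.S j)).Points K}
    (ha : a.pt ∈ (F.variety k).U i l) (h : (F.variety k).glue i j K a b) :
    b.pt ∈ (F.variety k).U j l ∧ ∀ c, (F.variety k).glue j l K b c → (F.variety k).glue i l K a c := by
  -- Axiom (c) concerns distinct indices only; coincidences reduce to reflexivity, symmetry and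
  -- uniqueness of gluing.
  by_cases hij : i = j
  · subst hij
    obtain rfl := glue_eq h
    exact ⟨ha, fun _ => id⟩
  by_cases hjl : j = l
  · subst hjl
    refine ⟨pt_mem_U_of_glue (glue_refl b), fun c hc => ?_⟩
    obtain rfl := glue_eq hc
    exact h
  by_cases hli : l = i
  · subst hli
    refine ⟨pt_mem_U_of_glue (glue_symm h), fun c hc => ?_⟩
    obtain rfl := glue_unique hc (glue_symm h)
    exact glue_refl _
  obtain ⟨u, v, w, hu, hv, hw, e₁, e₂⟩ := F.triple i j l hij hjl hli
  have hau := (pt_mem_U hu).1 (pt_mem_U_of_glue h)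
  have haw := (pt_mem_U hw.symm).1 ha
  obtain ⟨W, hW⟩ : ∃ W, W = F.S i ⊔ zspan (-u) ⊔ zspan w := ⟨_, rfl⟩
  have hi : F.S i ≤ W := hW ▸ le_sup_left.trans le_sup_left
  have huW : -u ∈ W := hW ▸
    (le_sup_right.trans le_sup_left : zspan (-u) ≤ F.S i ⊔ zspan (-u) ⊔ _) (self_mem_zspan _)
  have hj : F.S j ≤ W := (hW.trans e₁) ▸ le_sup_left.trans le_sup_left
  have hvW : -v ∈ W := (hW.trans e₁) ▸ (le_sup_right : zspan (-v) ≤ _) (self_mem_zspan _)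
  have hl : F.S l ≤ W := (hW.trans (e₁.trans e₂)) ▸ le_sup_left.trans le_sup_left
  -- Neither `χ^u` nor `χ^(-w)` vanishes at `a`, so `a` extends to a point `d` over the common
  -- semimodule; the glued points on the other two charts are restrictions of `d`.
  obtain ⟨d, rfl⟩ := exists_extension_sup_sup hi (by rw [hW, neg_neg]) a _ hau _ haw
  obtain rfl := glue_unique h (glue_of_restrict hu hi hj huW d)
  have hjl' := glue_of_restrict hv hj hl hvW d
  refine ⟨pt_mem_U_of_glue hjl', fun c hc => ?_⟩
  obtain rfl := glue_unique hc hjl'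
  exact glue_of_restrict hw.symm hi hl (by simpa using hl hw.mem) d

theorem glue_trans {a : (semialg k (F.S i)).Points K} {b : (semialg k (F.S j)).Points K}
    {c : (semialg k (F.S l)).Points K} (h : (F.variety k).glue i j K a b)
    (h' : (F.variety k).glue j l K b c) : (F.variety k).glue i l K a c :=
  -- The inner use, started from `b`, shows that `a` lies in the overlap of charts `i` and `l`.
  (cocycle (cocycle (pt_mem_U_of_glue h') (glue_symm h)).1 h).2 c h'

/-- Gluing is already an equivalence relation, so the quotient identifies nothing further. -/
theorem chartPt_eq_iff {a : (semialg k (F.S i)).Points K} {b : (semialg k (F.S j)).Points K} :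
    (F.variety k).chartPt i a = (F.variety k).chartPt j b ↔ (F.variety k).glue i j K a b := by
  refine ⟨fun h => ?_, fun h => Quot.sound h⟩
  have he : Equivalence fun a b : Σ i, ((F.variety k).V i).Points K =>
      (F.variety k).glue a.1 b.1 K a.2 b.2 :=
    ⟨fun a => glue_refl a.2, fun h => glue_symm h, fun h h' => glue_trans h h'⟩
  exact he.eqvGen_iff.1 (Quot.eqvGen_exact h)

/-- On `D(χ^v)` the character `χ^t` of the second chart is the fraction `χ^(t + g v) / χ^(g v)`. -/
theorem glue_regular {a : (semialg k (F.S i)).Points K} (ha : a.pt ∈ (F.variety k).U i j) :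
    LocallyTerm (A := semialg k (F.S i)) (B := semialg k (F.S j)) ((F.variety k).glue i j) a := by
  obtain ⟨v, hv⟩ := F.exists_adjoining i j
  choose g hg using fun t : F.S j => exists_add_smul_mem (hv.right_le t.2) hv.mem
  refine ⟨(semialg k (F.S i)).mono ⟨v, hv.mem⟩, Points.mem_units.1 ((pt_mem_U hv).1 ha),
    fun t => (semialg k (F.S i)).mono ⟨_, hg t⟩,
    fun t => (semialg k (F.S i)).mono (g t • ⟨v, hv.mem⟩),
    fun t => ⟨isTerm_mono (A := semialg k (F.S i)) _, isTerm_mono (A := semialg k (F.S i)) _⟩,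
    fun L a' ha' => ?_⟩
  have hu : (⟨v, hv.mem⟩ : F.S i) ∈ a'.units := Points.mem_units.2 ha'
  obtain ⟨b, hb⟩ := exists_glue ((pt_mem_U hv).2 hu)
  exact ⟨b, hb, fun t => ⟨Points.mem_units.1 (Submodule.smul_mem _ (g t) hu),
    glue_apply_mul hb t.2 _ (hg t)⟩⟩

theorem isAbstractVariety [Finite ι] : (F.variety k).IsAbstractVariety where
  finite := ‹_›
  affine i := isAffine_semialg _ (F.fg i)
  isOpen i j := by
    obtain ⟨v, hv⟩ := F.exists_adjoining i j
    rw [U_eq F hv]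
    exact isOpen_basicOpen _
  glue_mem _ _ _ _ _ h := ⟨pt_mem_U_of_glue h, pt_mem_U_of_glue (glue_symm h)⟩
  glue_existsUnique _ _ _ _ h := by
    obtain ⟨b, hb⟩ := exists_glue h
    exact ⟨b, hb, fun _ hb' => glue_unique hb' hb⟩
  glue_regular _ _ _ _ h := glue_regular h
  self i := by
    refine ⟨(U_eq F (adjoining_refl (F.S i))).trans ?_, fun _ a => glue_refl a⟩
    exact Set.eq_univ_of_forall fun p => zero_mem p.2.units
  symm _ _ _ _ _ h := glue_symm h
  cocycle _ _ _ _ _ _ ha h := cocycle ha h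

end Fan
end ToricPSigma

namespace ToricPSigma

open PSigmaAlg

variable {k : Type u} [Field k] [SigmaRing k] {n : ℕ}

/-- A finitely generated semimodule has an element that lies outside a `P[σ]`-prime ideal iff all
monomials do. -/
theorem exists_mem_units_iff_eq_top {S : Semimod n} (hS : S.FG) :
    ∃ s : S, ∀ p : (semialg k S).PSpec, s ∈ p.2.units ↔ p.2.units = ⊤ := by
  have : Module.Finite Px S := Module.Finite.of_fg hS
  obtain ⟨T, hT⟩ := Module.Finite.fg_top (R := Px) (M := S)
  -- The sum of the generators works: by the face property, if its monomial lies outside `p`, so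
  -- does that of each generator.
  refine ⟨∑ t ∈ T, t, fun p => ⟨fun h => ?_, fun h => h ▸ Submodule.mem_top⟩⟩
  rw [eq_top_iff, ← hT, Submodule.span_le]
  intro t ht
  classical
  have hsum : t + ∑ t ∈ T.erase t, t ∈ p.2.units := by
    rwa [Finset.add_sum_erase T (fun t => t) ht]
  exact (p.2.add_mem_units_iff.1 hsum).1

namespace Fan

variable {ι : Type} (F : Fan n ι) {K L : SigmaExt k}

/-! ### Points at which no character vanishes -/

theorem le_M (i : ι) : F.S i ≤ F.M.restrictScalars Px := by
  intro v hv
  rw [Submodule.restrictScalars_mem, ← F.md_eq i]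
  exact ⟨v, hv, 0, zero_mem _, by simp⟩

theorem sup_zspan_le_M {i : ι} {v : ZxN n} (hv : v ∈ F.S i) :
    F.S i ⊔ zspan (-v) ≤ F.M.restrictScalars Px :=
  sup_le (F.le_M i) (zspan_le (F.M.neg_mem (F.le_M i hv)) (by simpa using F.le_M i hv))

theorem exists_add_incl_eq (i : ι) (w : F.M.restrictScalars Px) :
    ∃ s t : F.S i, w + F.incl i t = F.incl i s := by
  have hw : w.1 ∈ md (F.S i) := (F.md_eq i).symm ▸ w.2
  obtain ⟨s, hs, t, ht, h⟩ := hw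
  exact ⟨⟨s, hs⟩, ⟨t, ht⟩, Subtype.ext (by
    change w.1 + t = s
    rw [h, sub_add_cancel])⟩

theorem incl_injective (i : ι) : Function.Injective (F.incl i) := Submodule.inclusion_injective _

theorem units_torus (c : (semialg k (F.M.restrictScalars Px)).Points K)
    (w : F.M.restrictScalars Px) : w ∈ c.units :=
  mem_units_of_neg_mem c w.2 (F.M.neg_mem w.2)

theorem units_restrict_incl (i : ι) (c : (semialg k (F.M.restrictScalars Px)).Points K) :
    (restrict (F.incl i) c).units = ⊤ := by
  refine eq_top_iff.2 fun v _ => ?_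
  rw [Points.mem_units, restrict_mono]
  exact Points.mem_units.1 (F.units_torus c _)

variable {F}

theorem exists_restrict_incl_eq {i : ι} {a : (semialg k (F.S i)).Points K} (ha : a.units = ⊤) :
    ∃ c, restrict (F.incl i) c = a :=
  exists_restrict_eq _ (F.incl_injective i) a fun w => by
    obtain ⟨s, t, h⟩ := F.exists_add_incl_eq i w
    exact ⟨s, t, h, ha ▸ Submodule.mem_top⟩

theorem restrict_incl_injective (i : ι) :
    Function.Injective fun c : (semialg k (F.M.restrictScalars Px)).Points K =>
      restrict (F.incl i) c :=
  restrict_injective _ fun w => by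
    obtain ⟨s, t, h⟩ := F.exists_add_incl_eq i w
    exact ⟨s, t, h, fun c => F.units_torus c _⟩

/-- The common extension of `a` and `b` is multiplied by the restriction of `s`, available because
the lattice contains `S_i + ℤ[x](-v)`. -/
theorem glue_mul {i j : ι} (s : (semialg k (F.M.restrictScalars Px)).Points K)
    {a : (semialg k (F.S i)).Points K} {b : (semialg k (F.S j)).Points K}
    (h : (F.variety k).glue i j K a b) :
    (F.variety k).glue i j K (restrict (F.incl i) s * a) (restrict (F.incl j) s * b) := by
  obtain ⟨v, W, hv, rfl, hi, hj, c, rfl, rfl⟩ := h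
  refine ⟨v, _, hv, rfl, hi, hj,
    restrict (Submodule.inclusion (F.sup_zspan_le_M hv.mem)) s * c, ?_, ?_⟩ <;>
  exact (restrict_mul _ _ _).trans (congrArg (· * _) (restrict_restrict _ _ _))

theorem glue_restrict_incl (i j : ι) (s : (semialg k (F.M.restrictScalars Px)).Points K) :
    (F.variety k).glue i j K (restrict (F.incl i) s) (restrict (F.incl j) s) := by
  obtain ⟨v, hv⟩ := F.exists_adjoining i j
  refine ⟨v, _, hv, rfl, le_sup_left, hv.right_le,
    restrict (Submodule.inclusion (F.sup_zspan_le_M hv.mem)) s, ?_, ?_⟩ <;>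
  exact restrict_restrict _ _ _

/-- Makes the torus locus well defined on the glued space: `b(χ^w)` is a factor of the nonzero value
`a(χ^(w + g v))`. -/
theorem units_eq_top_of_glue {i j : ι} {a : (semialg k (F.S i)).Points K}
    {b : (semialg k (F.S j)).Points K} (h : (F.variety k).glue i j K a b) (ha : a.units = ⊤) :
    b.units = ⊤ := by
  refine eq_top_iff.2 fun w _ => ?_
  obtain ⟨v, hv⟩ := F.exists_adjoining i j
  obtain ⟨g, hg⟩ := exists_add_smul_mem (hv.right_le w.2) hv.mem
  rw [Points.mem_units]
  refine left_ne_zero_of_mul (b := a ((semialg k (F.S i)).mono (g • ⟨v, hv.mem⟩))) ?_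
  refine (glue_apply_mul h w.2 (Submodule.smul_mem _ g hv.mem) hg).trans_ne ?_
  exact Points.mem_units.1 (ha ▸ Submodule.mem_top)

theorem units_eq_top_iff_of_specRel {p q : Σ i, ((F.variety k).V i).PSpec}
    (h : (F.variety k).SpecRel p q) : p.2.2.units = ⊤ ↔ q.2.2.units = ⊤ := by
  obtain ⟨K, a, b, ha, hb, h⟩ := h
  rw [← ha, ← hb]
  exact ⟨units_eq_top_of_glue h, units_eq_top_of_glue (glue_symm h)⟩

/-! ### The embedded torus -/

section Torus

variable (F) [Nonempty ι]

/-- The embedding of the torus. -/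
noncomputable def torusMap (K : SigmaExt k)
    (a : (semialg k (F.M.restrictScalars Px)).Points K) : (F.variety k).Points K :=
  (F.variety k).chartPt (Classical.arbitrary ι) (restrict (F.incl _) a)

theorem torusMap_eq (i : ι) (a : (semialg k (F.M.restrictScalars Px)).Points K) :
    F.torusMap K a = (F.variety k).chartPt i (restrict (F.incl i) a) :=
  chartPt_eq_iff.2 (glue_restrict_incl _ _ a)

variable (k) in
/-- The points of the space of the variety of a fan at which no character of the torus vanishes. -/
def torusLocus : Set (F.variety k).Space :=
  {x | Quot.lift (fun p : Σ i, ((F.variety k).V i).PSpec => p.2.2.units = ⊤)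
    (fun _ _ h => propext (units_eq_top_iff_of_specRel h)) x}

/-- A spectrum point outside all characters' zero sets comes from a field-valued point, which
extends to the lattice since no denominator vanishes. -/
theorem image_torusMap : GluingData.image (F.torusMap (k := k)) = F.torusLocus k := by
  ext x
  constructor
  · rintro ⟨K, t, rfl⟩
    exact F.units_restrict_incl _ t
  · induction x using Quot.ind with
    | mk p =>
      obtain ⟨i, p⟩ := p
      intro hp
      obtain ⟨K, a, rfl⟩ := exists_point p
      obtain ⟨c, rfl⟩ := exists_restrict_incl_eq (F := F) (a := a) hp
      refine ⟨K, c, ?_⟩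
      rw [F.torusMap_eq i]
      rfl

omit [Nonempty ι] in
theorem isOpen_torusLocus : IsOpen (F.torusLocus k) := by
  refine isOpen_coinduced.2 (isOpen_sigma_iff.2 fun i => ?_)
  obtain ⟨s, hs⟩ := exists_mem_units_iff_eq_top (k := k) (F.fg i)
  change IsOpen {p : (semialg k (F.S i)).PSpec | p.2.units = ⊤}
  rw [show {p : (semialg k (F.S i)).PSpec | p.2.units = ⊤} = basicOpen s from
    Set.ext fun p => (hs p).symm]
  exact isOpen_basicOpen s

/-- The embedding is monomial with denominator `1`. For its inverse, a lattice element is written as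
`s - t` with `s`, `t` in `S_i`, and its character is `χ^s / χ^t` where no character of the chart
vanishes. -/
theorem isOpenEmbedding_torusMap : GluingData.IsOpenEmbedding (F.torusMap (k := k)) where
  natural K L h t := congrArg ((F.variety k).chartPt _) (restrict_map _ h t)
  regular K t := by
    refine ⟨Classical.arbitrary ι, 1, ?_, fun u => mono _ (F.incl _ u), fun _ => mono _ 0,
      fun u => ⟨isTerm_mono _, isTerm_mono _⟩, fun L t' _ => ⟨restrict (F.incl _) t', rfl,
      fun u => ?_⟩⟩
    · rw [map_one]
      exact one_ne_zero
    · rw [t'.apply_mono_zero, mul_one]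
      exact ⟨one_ne_zero, restrict_mono _ _ u⟩
  isOpen := by
    rw [image_torusMap]
    exact F.isOpen_torusLocus
  injective K s t h := restrict_incl_injective _ (glue_eq (chartPt_eq_iff.1 h))
  surjOn K x hx := by
    rw [image_torusMap] at hx
    induction x using Quot.ind with
    | mk a =>
      obtain ⟨i, a⟩ := a
      obtain ⟨c, rfl⟩ := exists_restrict_incl_eq (F := F) (a := a) hx
      exact ⟨c, F.torusMap_eq i c⟩
  inv_regular i K a ha := by
    rw [image_torusMap] at ha
    obtain ⟨s, hs⟩ := exists_mem_units_iff_eq_top (k := k) (F.fg i)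
    choose num den h using F.exists_add_incl_eq i
    refine ⟨(semialg k (F.S i)).mono s, Points.mem_units.1 ((hs a.pt).2 ha),
      fun w => (semialg k (F.S i)).mono (num w), fun w => (semialg k (F.S i)).mono (den w),
      fun w => ⟨isTerm_mono (A := semialg k (F.S i)) _, isTerm_mono (A := semialg k (F.S i)) _⟩,
      fun L a' ha' => ?_⟩
    have hu : a'.units = ⊤ := (hs a'.pt).1 (Points.mem_units.2 ha')
    obtain ⟨c, rfl⟩ := exists_restrict_incl_eq (F := F) (a := a') hu
    refine ⟨c, F.torusMap_eq i c, fun w => ⟨Points.mem_units.1 (hu ▸ Submodule.mem_top), ?_⟩⟩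
    refine (congrArg (_ * ·) (restrict_mono (F.incl i) c (den w))).trans
      (Eq.trans ?_ (restrict_mono (F.incl i) c (num w)).symm)
    rw [← h w]
    exact (c.apply_mono_add _ _).symm

/-! ### Irreducibility -/

omit [Nonempty ι] in
/-- The generic points of the charts are identified. -/
theorem mk_genericPt_eq (i j : ι) :
    (Quot.mk _ ⟨i, genericPt (F.S i)⟩ : (F.variety k).Space) =
      Quot.mk _ ⟨j, genericPt (F.S j)⟩ := by
  obtain ⟨K, c, hc⟩ := exists_point (genericPt (k := k) (F.M.restrictScalars Px))
  -- As `k[S_i] → k[Σ^md]` is injective, the generic point of the torus pulls back to the zero ideal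
  -- of every chart.
  have key : ∀ i, (restrict (F.incl i) c).pt = genericPt (F.S i) := by
    intro i
    have hinj : Function.Injective (semialgMap k (F.incl i)) :=
      AddMonoidAlgebra.mapDomain_injective (F.incl_injective i)
    have hcomp : (restrict (F.incl i) c).toAlgHom = c.toAlgHom.comp (semialgMap k (F.incl i)) := by
      apply (AddMonoidAlgebra.lift k K (F.S i)).symm.injective
      refine MonoidHom.ext fun v => ?_
      exact (restrict_mono (F.incl i) c v.toAdd).trans
        (congrArg c.toAlgHom (semialgMap_mono (F.incl i) v.toAdd).symm)
    apply Subtype.ext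
    apply PrimeSpectrum.ext
    refine (Ideal.ext fun f => ?_ : RingHom.ker (restrict (F.incl i) c).toAlgHom = ⊥)
    rw [hcomp, RingHom.mem_ker, Ideal.mem_bot, ← map_eq_zero_iff _ hinj]
    change semialgMap k (F.incl i) f ∈ c.pt.1.asIdeal ↔ _
    rw [hc]
    exact Iff.rfl
  rw [← key i, ← key j]
  exact congrArg (F.variety k).pt (chartPt_eq_iff.2 (glue_restrict_incl i j c))

/-- The common generic point of the charts specializes to every point, so the space is the closure
of one point. -/
theorem irreducibleSpace : IrreducibleSpace (F.variety k).Space := by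
  let η : (F.variety k).Space := Quot.mk _ ⟨Classical.arbitrary ι, genericPt (F.S _)⟩
  have hη : ∀ x, η ⤳ x := by
    intro x
    induction x using Quot.ind with
    | mk p =>
      obtain ⟨i, p⟩ := p
      have h : η = Quot.mk _ ⟨i, genericPt (F.S i)⟩ := F.mk_genericPt_eq _ _
      rw [h]
      have h1 : Continuous fun p : ((F.variety k).V i).PSpec =>
          (Quot.mk _ ⟨i, p⟩ : (F.variety k).Space) := continuous_coinduced_rng.comp continuous_sigmaMk
      exact (genericPt_specializes (F.S i) p).map h1
  have : (Set.univ : Set (F.variety k).Space) = closure {η} :=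
    (Set.eq_univ_of_forall fun x => (hη x).mem_closure).symm
  have hirr : IsIrreducible (Set.univ : Set (F.variety k).Space) :=
    this ▸ isIrreducible_singleton.closure
  exact { toNonempty := ⟨η⟩, isPreirreducible_univ := hirr.2 }

end Torus

/-! ### The action of the torus -/

/-- The action of the torus on a chart of the variety of a fan. -/
noncomputable def chartAction (i : ι) (s : (semialg k (F.M.restrictScalars Px)).Points K)
    (a : (semialg k (F.S i)).Points K) : (semialg k (F.S i)).Points K :=
  restrict (F.incl i) s * a

theorem chartAction_mono (i : ι) (s : (semialg k (F.M.restrictScalars Px)).Points K)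
    (a : (semialg k (F.S i)).Points K) (u : F.S i) :
    chartAction i s a ((semialg k (F.S i)).mono u) =
      s ((semialg k (F.M.restrictScalars Px)).mono (F.incl i u)) *
        a ((semialg k (F.S i)).mono u) :=
  (mul_mono _ _ u).trans (congrArg (· * _) (restrict_mono (F.incl i) s u))

theorem chartAction_map (i : ι) (h : K.Hom L) (s : (semialg k (F.M.restrictScalars Px)).Points K)
    (a : (semialg k (F.S i)).Points K) :
    chartAction i (s.map h) (a.map h) = (chartAction i s a).map h :=
  (congrArg (· * _) (restrict_map _ h s)).trans (map_mul_points h _ _).symm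

theorem chartAction_one (i : ι) (a : (semialg k (F.S i)).Points K) : chartAction i 1 a = a :=
  semialg_points_ext fun u => by rw [chartAction_mono, one_mono, one_mul]

theorem chartAction_mul (i : ι) (s t : (semialg k (F.M.restrictScalars Px)).Points K)
    (a : (semialg k (F.S i)).Points K) :
    chartAction i (s * t) a = chartAction i s (chartAction i t a) :=
  semialg_points_ext fun u => by
    rw [chartAction_mono, chartAction_mono, chartAction_mono, mul_mono, mul_assoc]

variable (F) in
/-- The action of the torus on the variety of a fan. -/
noncomputable def torusAction (K : SigmaExt k)
    (s : (semialg k (F.M.restrictScalars Px)).Points K) :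
    (F.variety k).Points K → (F.variety k).Points K :=
  Quot.map (fun a => ⟨a.1, chartAction a.1 s a.2⟩) fun _ _ h => glue_mul s h

theorem tensor_apply_mono {A B : PSigmaAlg k} (c : (A.tensor B).Points K) (u : A.Mon) (v : B.Mon) :
    c ((A.tensor B).mono (u, v)) = c.fst (A.mono u) * c.snd (B.mono v) := by
  refine (congrArg c.toAlgHom ?_).trans (map_mul c.toAlgHom (A.mono u ⊗ₜ 1 : A ⊗[k] B)
    (1 ⊗ₜ B.mono v : A ⊗[k] B))
  change (A.mono u ⊗ₜ B.mono v : A ⊗[k] B) = (A.mono u ⊗ₜ 1) * (1 ⊗ₜ B.mono v)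
  rw [Algebra.TensorProduct.tmul_mul_tmul, mul_one, one_mul]

/-- On each chart the action is dual to `χ^u ↦ χ^u ⊗ χ^u`, hence given by terms with denominator
`1`; the axioms are checked on characters chart by chart. -/
theorem isTorusAction : GluingData.IsTorusAction (F.torusAction (k := k)) where
  natural K L h t x := by
    induction x using Quot.ind with
    | mk a => exact congrArg ((F.variety k).chartPt a.1) (chartAction_map a.1 h t a.2)
  regular i K c := by
    refine ⟨i, 1, ?_, fun u => mono _ (F.incl i u, u), fun _ => mono _ 0,
      fun u => ⟨isTerm_mono _, isTerm_mono _⟩, fun L c' _ =>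
      ⟨chartAction i c'.fst c'.snd, rfl, fun u => ?_⟩⟩
    · rw [map_one]
      exact one_ne_zero
    · rw [c'.apply_mono_zero, mul_one]
      exact ⟨one_ne_zero, (chartAction_mono i c'.fst c'.snd u).trans
        (tensor_apply_mono c' (F.incl i u) u).symm⟩
  one K x := by
    induction x using Quot.ind with
    | mk a => exact congrArg ((F.variety k).chartPt a.1) (chartAction_one a.1 a.2)
  mul K s t x := by
    induction x using Quot.ind with
    | mk a => exact congrArg ((F.variety k).chartPt a.1) (chartAction_mul a.1 s t a.2)

end Fan
end ToricPSigma

theorem mainTheorem10 {k : Type u} [Field k] [CharZero k] [ToricPSigma.SigmaRing k]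
    {n : ℕ} {ι : Type} [Finite ι] [Nonempty ι] (F : ToricPSigma.Fan n ι) :
    (∀ (i j : ι) (v : ToricPSigma.ZxN n) (hv : ToricPSigma.Adjoining (F.S i) (F.S j) v),
      (F.variety k).U i j = ToricPSigma.basicOpen (k := k) (⟨v, hv.mem⟩ : F.S i)) ∧
    ∃ t : ∀ K : ToricPSigma.SigmaExt k,
        (ToricPSigma.semialg k (F.M.restrictScalars ToricPSigma.Px)).Points K →
          (F.variety k).Points K,
      (∀ (i : ι) (K : ToricPSigma.SigmaExt k)
        (a : (ToricPSigma.semialg k (F.M.restrictScalars ToricPSigma.Px)).Points K),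
        t K a = (F.variety k).chartPt i (ToricPSigma.restrict (F.incl i) a)) ∧
      (F.variety k).IsToricVia F.M t :=
  ⟨fun _ _ _ hv => F.U_eq hv, F.torusMap, fun i _ a => F.torusMap_eq i a,
    { variety := F.isAbstractVariety
      irreducible := F.irreducibleSpace
      isOpenEmbedding := F.isOpenEmbedding_torusMap
      action := ⟨F.torusAction, ToricPSigma.Fan.isTorusAction, fun _ s t =>
        -- On the chart defining the embedding, compatibility with the product of the torus is
        -- multiplicativity of restriction.
        congrArg ((F.variety k).chartPt _) (ToricPSigma.restrict_mul _ s t).symm⟩ }⟩
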